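/- Let $T\ge 0$ and let $u:[0,T]\times\mathbb R^3\to\mathbb R^3$ be a vector field with $u\in L^1(0,T;W^{1,\infty}(\mathbb R^3))$, whose weak time derivative $\partial_t u$ is a function that is locally integrable on $[0,T]\times\mathbb R^3$; $u(t)$ denotes, for every $t\in[0,T]$, the value of the representative of $u$ that is continuous in time (with values in $L^1_{\mathrm{loc}}(\mathbb R^3)$). Let $0\le f\in L^\infty(0,T;L^1\cap L^\infty(\mathbb R^3\times\mathbb R^3))$ be a weak (distributional) solution on $[0,T]$ of the Vlasov equation $$\partial_t f+v\cdot\nabla_x f+\operatorname{div}_v[f(u-v)]=0,$$ weakly continuous in time, with initial value $f(0)=f_0$. (This covers the Vlasov–Navier–Stokes system: there $u$ moreover solves the incompressible Navier–Stokes equations with force $\int (v-u)f\,dv$, which is not needed here.) For $p\ge2$ set $$D_p(t):=\iint_{\mathbb R^3\times\mathbb R^3} f(t,x,v)\,|v-u(t,x)|^p\,dv\,dx .$$ Let $\varphi\in C^1([0,+\infty))$, $p\ge2$ and $t\in[0,T]$, and suppose that the terms of the identity below have a meaning, in the sense that $D_p(0)<\infty$ and that $$f\,[\partial_s u+(\nabla_x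 u)v]\cdot(v-u)\,|v-u|^{p-2}$$ is integrable on $(0,t)\times\mathbb R^3\times\mathbb R^3$. Then $D_p(s)<\infty$ for every $s\in[0,t]$, the functions $D_p\varphi$ and $D_p\varphi'$ are integrable on $(0,t)$, and $$\begin{aligned}\int_0^t D_p(s)\varphi(s)\,ds={}&\frac1p\int_0^t D_p(s)\varphi'(s)\,ds\\&-\int_0^t\iint_{\mathbb R^3\times\mathbb R^3} f(s,x,v)\,[\partial_s u+(\nabla_x u)v]\cdot[v-u(s,x)]\,|v-u(s,x)|^{p-2}\varphi(s)\,dv\,dx\,ds\\&-\left[\frac{\varphi(s)}{p}D_p(s)\right]_{s=0}^{s=t}.\end{aligned}$$ -/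

import Mathlib

open MeasureTheory Set
open scoped ContDiff ENNReal

noncomputable section

/-- Euclidean space `ℝ³`; phase space is `R3 × R3`, with points `z = (x, v)`. -/
abbrev R3 : Type := EuclideanSpace ℝ (Fin 3)

/-- `G` is the weak gradient of `w : ℝ³ → ℝ³`:
`∫ (∂_e ψ) w = - ∫ ψ (G e)` for all directions `e` and all test functions `ψ`. -/
def IsWeakGradient (w : R3 → R3) (G : R3 → R3 →L[ℝ] R3) : Prop :=
  LocallyIntegrable w ∧ LocallyIntegrable G ∧
    ∀ (ψ : R3 → ℝ), ContDiff ℝ ∞ ψ → HasCompactSupport ψ → ∀ e : R3,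
      ∫ x, (fderiv ℝ ψ x e) • w x = - ∫ x, ψ x • G x e

/-- `ut` is the weak time derivative of `u` on `(0,T) × ℝ³`, it is locally integrable up to the
boundary times, and `t ↦ u t` is the representative that is continuous in time on `[0,T]` (so that
`u t` is meaningful at each time). Test functions supported in `(0,T) × ℝ³` give
`∫∫ (∂ₛψ) u = - ∫∫ ψ ut`. -/
structure IsWeakTimeDeriv (T : ℝ) (u ut : ℝ → R3 → R3) : Prop where
  locallyIntegrable : ∀ t ∈ Icc 0 T, LocallyIntegrable (u t)
  locallyIntegrable_deriv :
    LocallyIntegrableOn (fun y : ℝ × R3 => ut y.1 y.2) (Icc 0 T ×ˢ univ)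
  weak_eq : ∀ (ψ : ℝ × R3 → ℝ), ContDiff ℝ ∞ ψ → HasCompactSupport ψ → ∀ t ∈ Icc 0 T,
    (∫ x, ψ (t, x) • u t x) - (∫ x, ψ (0, x) • u 0 x) =
      ∫ s in (0)..t, ∫ x, ((fderiv ℝ ψ (s, x) (1, 0)) • u s x + ψ (s, x) • ut s x)

/-- `u ∈ L¹(0,T; W^{1,∞}(ℝ³))` with weak spatial gradient `Du`; here `Du s x v = (∇ₓ u(s,x)) v`. -/
structure IsL1Lipschitz (T : ℝ) (u : ℝ → R3 → R3) (Du : ℝ → R3 → R3 →L[ℝ] R3) : Prop where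
  aestronglyMeasurable : AEStronglyMeasurable (fun y : ℝ × R3 => u y.1 y.2)
    ((volume.restrict (Ioc 0 T)).prod volume)
  aestronglyMeasurable_grad : AEStronglyMeasurable (fun y : ℝ × R3 => Du y.1 y.2)
    ((volume.restrict (Ioc 0 T)).prod volume)
  weakGradient : ∀ᵐ s ∂(volume.restrict (Ioc 0 T)), IsWeakGradient (u s) (Du s)
  norm_lt_top : (∫⁻ s in Ioc 0 T,
    (eLpNorm (u s) ⊤ volume + eLpNorm (Du s) ⊤ volume)) < ⊤

/-- `0 ≤ f ∈ L^∞(0,T; L¹ ∩ L^∞(ℝ³ × ℝ³))` is a weak solution on `[0,T]`, with initial value `f 0`,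
of the Vlasov equation `∂ₜ f + v · ∇ₓ f + div_v (f (u - v)) = 0`. For a test function `ψ`,
`fderiv ℝ ψ (s, x, v) (1, v, u - v)` is `∂ₛψ + v · ∇ₓψ + (u - v) · ∇_v ψ`. -/
structure IsVlasovSolution (T : ℝ) (u : ℝ → R3 → R3) (f : ℝ → R3 × R3 → ℝ) : Prop where
  aestronglyMeasurable : AEStronglyMeasurable (fun y : ℝ × (R3 × R3) => f y.1 y.2)
    ((volume.restrict (Ioc 0 T)).prod volume)
  aestronglyMeasurable_slice : ∀ t ∈ Icc 0 T, AEStronglyMeasurable (f t) volume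
  nonneg : ∀ t ∈ Icc 0 T, ∀ᵐ z, 0 ≤ f t z
  bounded : ∃ C : ℝ≥0∞, C < ⊤ ∧ ∀ t ∈ Icc 0 T,
    eLpNorm (f t) 1 volume ≤ C ∧ eLpNorm (f t) ⊤ volume ≤ C
  weak_eq : ∀ (ψ : ℝ × (R3 × R3) → ℝ), ContDiff ℝ ∞ ψ → HasCompactSupport ψ → ∀ t ∈ Icc 0 T,
    (∫ z, f t z * ψ (t, z)) - (∫ z, f 0 z * ψ (0, z)) =
      ∫ s in (0)..t, ∫ z, f s z * fderiv ℝ ψ (s, z) (1, (z.2, u s z.1 - z.2))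

/-- The density `f(t,x,v) |v - u(t,x)|^p` of the higher fluid-kinetic dissipation. -/
def dissipationDensity (p : ℝ) (u : ℝ → R3 → R3) (f : ℝ → R3 × R3 → ℝ) (t : ℝ)
    (z : R3 × R3) : ℝ :=
  f t z * ‖z.2 - u t z.1‖ ^ p

/-- The higher fluid-kinetic dissipation `D_p(t) = ∬ f(t,x,v) |v - u(t,x)|^p dv dx`. -/
def higherDissipation (p : ℝ) (u : ℝ → R3 → R3) (f : ℝ → R3 × R3 → ℝ) (t : ℝ) : ℝ :=
  ∫ z, dissipationDensity p u f t z

/-- The function `f [∂ₛu + (∇ₓu) v] · (v - u) |v - u|^{p-2}` at time `s` and `z = (x, v)`. -/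
def accelerationDensity (p : ℝ) (u ut : ℝ → R3 → R3) (Du : ℝ → R3 → R3 →L[ℝ] R3)
    (f : ℝ → R3 × R3 → ℝ) (s : ℝ) (z : R3 × R3) : ℝ :=
  f s z * inner ℝ (ut s z.1 + Du s z.1 z.2) (z.2 - u s z.1) * ‖z.2 - u s z.1‖ ^ (p - 2)

end

/-! Along the characteristics `x' = v`, `v' = u - v`, the relative velocity `w = v - u` obeys `w' =
-w - a` with `a = ∂ₛu + (∇ₓu)v`. Hence `|w|^p` changes at rate `-p|w|^p - p|w|^(p-2) w·a`, and
integration against the transported density `f` gives `D_p' = -p (D_p + A)`, where `A(s)` is the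
phase-space integral of `accelerationDensity`. Multiplying by `φ` and integrating by parts in time
yields the identity.

The function `|v - u|^p` is not an admissible test function: `u` is not smooth, the support is not
compact, and the power is unbounded and possibly singular at `w = 0`. The test functions used are
`χ(x,v) γ(|v - U|²)`, and three limits remove the three regularizations.

(1) `U → u` with `χ`, `γ` fixed (`cutoff_identity`). By `exists_seq_contDiff_approx` there are
smooth `U` converging almost everywhere in space at every time of `[0,T]`, whose derivatives along
`(1,v)` converge to `a` in `L¹` of bounded sets. As `f` and `γ'(|w|²)w` are bounded, this suffices.

(2) `χ → 1` with `γ` fixed (`renormalized_identity`). The derivatives of the rescaled cutoff along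
the flow are bounded by a constant times `2 + |u|`, and both `f` and `f|u|` are integrable.

(3) `γ(r) → r^(p/2)` along `truncatedPower`. Since `γ' ≥ 0`, the term `-2fγ'|w|²` has a sign, so the
truncated moments are at most `D_p(0) + p∫|A-density|`, and Fatou's lemma gives the same bound for
`D_p(s)` (`lintegral_dissipationDensity_le`). Only then is dominated convergence available for the
exact evolution law (`higherDissipation_sub`). -/

open Filter Topology

noncomputable section

/-! ### Mollification in space. -/

section Mollify

variable {E : Type*} [NormedAddCommGroup E] [NormedSpace ℝ E]

/-- Mollification of `g` by a normalized bump function. -/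
def mollify (ρ : ContDiffBump (0 : R3)) (g : R3 → E) (x : R3) : E :=
  ∫ y, ρ.normed volume (x - y) • g y

theorem mollify_eq_convolution (ρ : ContDiffBump (0 : R3)) (g : R3 → E) :
    mollify ρ g = convolution (ρ.normed volume) g (ContinuousLinearMap.lsmul ℝ ℝ) volume := by
  ext x
  rw [convolution_eq_swap]
  rfl

theorem mollify_congr_ae (ρ : ContDiffBump (0 : R3)) {g g' : R3 → E} (h : g =ᵐ[volume] g') :
    mollify ρ g = mollify ρ g' := by
  ext x
  refine integral_congr_ae ?_
  filter_upwards [h] with y hy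
  rw [hy]

theorem contDiff_mollify [CompleteSpace E] (ρ : ContDiffBump (0 : R3)) {g : R3 → E}
    (hg : LocallyIntegrable g) : ContDiff ℝ ∞ (mollify ρ g) := by
  rw [mollify_eq_convolution]
  exact ρ.hasCompactSupport_normed.contDiff_convolution_left _ ρ.contDiff_normed hg

theorem normed_sub_eq_zero {ρ : ContDiffBump (0 : R3)} (hρ : ρ.rOut ≤ 1) {R : ℝ} {x y : R3}
    (hx : x ∈ Metric.ball (0 : R3) R) (hy : y ∉ Metric.ball (0 : R3) (R + 1)) :
    ρ.normed volume (x - y) = 0 := by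
  by_contra h
  have h1 : x - y ∈ Function.support (ρ.normed volume) := h
  rw [ρ.support_normed_eq] at h1
  simp only [Metric.mem_ball, dist_zero_right] at h1 hx hy
  have : ‖y‖ ≤ ‖x‖ + ‖x - y‖ := by
    have := norm_sub_le x (x - y)
    simpa using this
  apply hy
  linarith

theorem integrable_normed_sub_smul {ρ : ContDiffBump (0 : R3)} (hρ : ρ.rOut ≤ 1) {R : ℝ} {x : R3}
    (hx : x ∈ Metric.ball (0 : R3) R) {g : R3 → E}
    (hg : IntegrableOn g (Metric.ball 0 (R + 1))) :
    Integrable (fun y => ρ.normed volume (x - y) • g y) := by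
  have h1 : IntegrableOn (fun y => ρ.normed volume (x - y) • g y) (Metric.ball 0 (R + 1)) := by
    obtain ⟨C, hC⟩ := ρ.hasCompactSupport_normed.exists_bound_of_continuous
      (ρ.continuous_normed (μ := volume))
    refine Integrable.bdd_smul (C := C) hg ?_ ?_
    · exact (ρ.continuous_normed.comp (by fun_prop)).aestronglyMeasurable
    · exact Eventually.of_forall fun y => hC _
  refine (integrableOn_iff_integrable_of_support_subset ?_).1 h1
  intro y hy
  by_contra hy'
  exact hy (by simp [normed_sub_eq_zero hρ hx hy'])

theorem lintegral_ofReal_normed_sub (ρ : ContDiffBump (0 : R3)) (y : R3) :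
    ∫⁻ x, ENNReal.ofReal (ρ.normed volume (x - y)) = 1 := by
  rw [lintegral_sub_right_eq_self (fun x => ENNReal.ofReal (ρ.normed volume x)) y,
    ← ofReal_integral_eq_lintegral_ofReal ρ.integrable_normed
      (Eventually.of_forall ρ.nonneg_normed), ρ.integral_normed, ENNReal.ofReal_one]

/-- Local form of Young's inequality: the kernel has mass one, and its support in the unit ball
explains the loss of one unit of radius. -/
theorem lintegral_enorm_mollify_le {ρ : ContDiffBump (0 : R3)} (hρ : ρ.rOut ≤ 1) (R : ℝ)
    {g : R3 → E} (hg : AEStronglyMeasurable g (volume.restrict (Metric.ball 0 (R + 1)))) :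
    ∫⁻ x in Metric.ball 0 R, ‖mollify ρ g x‖ₑ ≤ ∫⁻ y in Metric.ball 0 (R + 1), ‖g y‖ₑ := by
  calc ∫⁻ x in Metric.ball 0 R, ‖mollify ρ g x‖ₑ
      ≤ ∫⁻ x in Metric.ball 0 R, ∫⁻ y in Metric.ball 0 (R + 1),
          ENNReal.ofReal (ρ.normed volume (x - y)) * ‖g y‖ₑ := by
        refine setLIntegral_mono' measurableSet_ball fun x hx => ?_
        refine (enorm_integral_le_lintegral_enorm _).trans ?_
        rw [← lintegral_indicator measurableSet_ball]
        refine lintegral_mono fun y => ?_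
        by_cases hy : y ∈ Metric.ball (0 : R3) (R + 1)
        · rw [indicator_of_mem hy, enorm_smul, Real.enorm_eq_ofReal (ρ.nonneg_normed _)]
        · simp [normed_sub_eq_zero hρ hx hy]
    _ = ∫⁻ y in Metric.ball 0 (R + 1), ∫⁻ x in Metric.ball 0 R,
          ENNReal.ofReal (ρ.normed volume (x - y)) * ‖g y‖ₑ := by
        refine lintegral_lintegral_swap ?_
        refine AEMeasurable.mul (f := fun p : R3 × R3 => ENNReal.ofReal (ρ.normed volume (p.1 - p.2)))
          (g := fun p : R3 × R3 => ‖g p.2‖ₑ) ?_ ?_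
        · exact ((ρ.continuous_normed (μ := volume)).comp
            (by fun_prop : Continuous fun p : R3 × R3 => p.1 - p.2)).measurable.ennreal_ofReal.aemeasurable
        · exact hg.comp_snd.enorm
    _ ≤ ∫⁻ y in Metric.ball 0 (R + 1), ‖g y‖ₑ := by
        refine lintegral_mono fun y => ?_
        rw [lintegral_mul_const']
        · calc _ ≤ 1 * ‖g y‖ₑ := by
                gcongr
                rw [← lintegral_ofReal_normed_sub ρ y]
                exact setLIntegral_le_lintegral _ _
            _ = _ := one_mul _
        · exact enorm_ne_top

/-- A jointly measurable representative has, for almost every `s`, the same slice up to a null set,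
and mollification does not see null sets. -/
theorem aestronglyMeasurable_mollify_prod (ρ : ContDiffBump (0 : R3)) {μ : Measure ℝ} [SFinite μ]
    {F : ℝ → R3 → E}
    (hF : AEStronglyMeasurable (fun y : ℝ × R3 => F y.1 y.2) (μ.prod volume)) :
    AEStronglyMeasurable (fun y : ℝ × R3 => mollify ρ (F y.1) y.2) (μ.prod volume) := by
  set G := hF.mk _ with hG
  have h1 : StronglyMeasurable G := hF.stronglyMeasurable_mk
  have h2 : ∀ᵐ s ∂μ, F s =ᵐ[volume] fun x => G (s, x) := Measure.ae_ae_of_ae_prod hF.ae_eq_mk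
  refine ⟨fun y => mollify ρ (fun x => G (y.1, x)) y.2, ?_, ?_⟩
  · refine StronglyMeasurable.integral_prod_right (f := fun (y : ℝ × R3) (x : R3) =>
      ρ.normed volume (y.2 - x) • G (y.1, x)) ?_
    refine StronglyMeasurable.smul ?_ ?_
    · exact ((ρ.continuous_normed (μ := volume)).comp
        (by fun_prop : Continuous fun p : (ℝ × R3) × R3 => p.1.2 - p.2)).stronglyMeasurable
    · exact h1.comp_measurable (by fun_prop)
  · have h3 : ∀ᵐ y ∂(μ.prod (volume : Measure R3)), F y.1 =ᵐ[volume] fun x => G (y.1, x) :=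
      Measure.quasiMeasurePreserving_fst.ae h2
    filter_upwards [h3] with y hy
    rw [mollify_congr_ae ρ hy]

/-- The scale `δ` works for every bump, so that one bump can later serve both `ut` and `Du`. With
`a` smooth, compactly supported and `L¹`-close to `F`, the error splits as `ρ*(F - a) + (ρ*a - a) -
(F - a)`; uniform continuity of `a` controls the middle term. -/
theorem exists_forall_lintegral_mollify_sub_le [CompleteSpace E]
    {μ : Measure ℝ} [IsFiniteMeasure μ] {R : ℝ} {F : ℝ → R3 → E}
    (hF : Integrable (fun y : ℝ × R3 => F y.1 y.2)
      (μ.prod (volume.restrict (Metric.ball 0 (R + 1)))))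
    {ε : ℝ} (hε : 0 < ε) :
    ∃ δ > 0, ∀ ρ : ContDiffBump (0 : R3), ρ.rOut ≤ δ →
      ∫⁻ s, (∫⁻ x in Metric.ball 0 R, ‖mollify ρ (F s) x - F s x‖ₑ) ∂μ ≤ ENNReal.ofReal ε := by
  -- The error `F - a` enters twice, once mollified, for a total of `ε/2`; the other half is left to
  -- `ρ*a - a`.
  obtain ⟨a, ha1, ha2, ha3⟩ := (memLp_one_iff_integrable.2 hF).exist_eLpNorm_sub_le
    ENNReal.one_ne_top le_rfl (ε := ε / 4) (by positivity)
  rw [eLpNorm_one_eq_lintegral_enorm] at ha3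
  -- `V` is the measure over which the uniform error of `ρ*a - a` is integrated; dividing by `V + 1`
  -- avoids the case `V = 0`.
  set V : ℝ := (μ univ).toReal * (volume (Metric.ball (0 : R3) R)).toReal with hV
  have hV0 : 0 ≤ V := by positivity
  have huc := Metric.uniformContinuous_iff.1
    (ha1.uniformContinuous_of_continuous ha2.continuous) (ε / (2 * (V + 1))) (by positivity)
  obtain ⟨δ, hδ, hδ'⟩ := huc
  refine ⟨min δ 1, by positivity, fun ρ hρ => ?_⟩
  have hρ1 : ρ.rOut ≤ 1 := hρ.trans (min_le_right _ _)
  have hρδ : ρ.rOut ≤ δ := hρ.trans (min_le_left _ _)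
  have hFa : AEStronglyMeasurable (fun y : ℝ × R3 => F y.1 y.2 - a y)
      (μ.prod (volume.restrict (Metric.ball 0 (R + 1)))) :=
    hF.1.sub ha2.continuous.aestronglyMeasurable
  have hslice : ∀ᵐ s ∂μ, IntegrableOn (F s) (Metric.ball 0 (R + 1)) := hF.prod_right_ae
  set e : ℝ → ℝ≥0∞ := fun s => ∫⁻ x in Metric.ball 0 (R + 1), ‖F s x - a (s, x)‖ₑ with he
  have hem : AEMeasurable e μ := hFa.enorm.lintegral_prod_right'
  have heint : ∫⁻ s, e s ∂μ ≤ ENNReal.ofReal (ε / 4) := by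
    rw [lintegral_prod _ (by exact hFa.enorm)] at ha3
    exact ha3
  have hball : Metric.ball (0 : R3) R ⊆ Metric.ball 0 (R + 1) :=
    Metric.ball_subset_ball (by linarith)
  have hkey : ∀ᵐ s ∂μ, ∫⁻ x in Metric.ball 0 R, ‖mollify ρ (F s) x - F s x‖ₑ ≤
      2 * e s + ENNReal.ofReal (ε / (2 * (V + 1))) * volume (Metric.ball (0 : R3) R) := by
    filter_upwards [hslice] with s hs
    have has : Continuous fun x => a (s, x) := ha2.continuous.comp (by fun_prop)
    have haI : IntegrableOn (fun x => a (s, x)) (Metric.ball 0 (R + 1)) :=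
      (has.locallyIntegrable.integrableOn_isCompact
        (isCompact_closedBall 0 (R + 1))).mono_set Metric.ball_subset_closedBall
    have hm : AEStronglyMeasurable (fun x => F s x - a (s, x))
        (volume.restrict (Metric.ball 0 (R + 1))) := hs.1.sub haI.1
    calc ∫⁻ x in Metric.ball 0 R, ‖mollify ρ (F s) x - F s x‖ₑ
        ≤ ∫⁻ x in Metric.ball 0 R, (‖mollify ρ (fun x => F s x - a (s, x)) x‖ₑ +
          (ENNReal.ofReal (ε / (2 * (V + 1))) + ‖F s x - a (s, x)‖ₑ)) := by
          refine setLIntegral_mono' measurableSet_ball fun x hx => ?_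
          have h1 : mollify ρ (fun x => F s x - a (s, x)) x =
              mollify ρ (F s) x - mollify ρ (fun x => a (s, x)) x := by
            unfold mollify
            rw [← integral_sub (integrable_normed_sub_smul hρ1 hx hs)
              (integrable_normed_sub_smul hρ1 hx haI)]
            simp_rw [smul_sub]
          have h2 : mollify ρ (F s) x - F s x = mollify ρ (fun x => F s x - a (s, x)) x +
              ((mollify ρ (fun x => a (s, x)) x - a (s, x)) + -(F s x - a (s, x))) := by
            rw [h1]; abel
          rw [h2]
          refine (enorm_add_le _ _).trans (add_le_add le_rfl ((enorm_add_le _ _).trans ?_))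
          rw [enorm_neg]
          refine add_le_add ?_ le_rfl
          rw [← ofReal_norm, ← dist_eq_norm, mollify_eq_convolution]
          refine ENNReal.ofReal_le_ofReal ?_
          refine ContDiffBump.dist_normed_convolution_le has.aestronglyMeasurable fun y hy => ?_
          refine (hδ' ?_).le
          rw [Prod.dist_eq, dist_self]
          exact max_lt hδ (lt_of_lt_of_le hy hρδ)
      _ = (∫⁻ x in Metric.ball 0 R, ‖mollify ρ (fun x => F s x - a (s, x)) x‖ₑ) +
          (ENNReal.ofReal (ε / (2 * (V + 1))) * volume (Metric.ball (0 : R3) R) +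
          ∫⁻ x in Metric.ball 0 R, ‖F s x - a (s, x)‖ₑ) := by
          rw [lintegral_add_right', lintegral_add_left measurable_const, lintegral_const,
            Measure.restrict_apply_univ]
          exact aemeasurable_const.add (hm.mono_measure (Measure.restrict_mono hball le_rfl)).enorm
      _ ≤ e s + (ENNReal.ofReal (ε / (2 * (V + 1))) * volume (Metric.ball (0 : R3) R) + e s) := by
          gcongr
          · exact lintegral_enorm_mollify_le hρ1 R hm
          · exact lintegral_mono_set hball
      _ = _ := by ring
  calc _ ≤ ∫⁻ s, (2 * e s +
        ENNReal.ofReal (ε / (2 * (V + 1))) * volume (Metric.ball (0 : R3) R)) ∂μ :=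
        lintegral_mono_ae hkey
    _ = 2 * ∫⁻ s, e s ∂μ +
        ENNReal.ofReal (ε / (2 * (V + 1))) * volume (Metric.ball (0 : R3) R) * μ univ := by
        rw [lintegral_add_right _ measurable_const, lintegral_const,
          lintegral_const_mul'' _ hem]
    _ ≤ 2 * ENNReal.ofReal (ε / 4) + ENNReal.ofReal (ε / (2 * (V + 1)) * V) := by
        gcongr
        rw [ENNReal.ofReal_mul (by positivity), mul_assoc, hV, ENNReal.ofReal_mul (by positivity),
          ENNReal.ofReal_toReal (measure_ne_top _ _),
          ENNReal.ofReal_toReal measure_ball_lt_top.ne, mul_comm (volume _)]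
    _ ≤ ENNReal.ofReal ε := by
        rw [show (2 : ℝ≥0∞) = ENNReal.ofReal 2 by simp, ← ENNReal.ofReal_mul (by norm_num),
          ← ENNReal.ofReal_add (by positivity) (by positivity)]
        refine ENNReal.ofReal_le_ofReal ?_
        have : ε / (2 * (V + 1)) * V ≤ ε / 2 := by
          rw [div_mul_eq_mul_div, div_le_div_iff₀ (by positivity) (by positivity)]
          nlinarith
        linarith

end Mollify

/-! ### Joint smoothness in time and space, and weak derivatives under mollification. -/

theorem contDiff_mollify_param (ρ : ContDiffBump (0 : R3)) {a : ℝ × R3 → R3}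
    (ha : ContDiff ℝ ∞ a) (hac : HasCompactSupport a) :
    ContDiff ℝ ∞ fun y : ℝ × R3 => mollify ρ (fun x => a (y.1, x)) y.2 := by
  have h := contDiffOn_convolution_right_with_param (𝕜 := ℝ) (n := ⊤) (μ := (volume : Measure R3))
    (f := ρ.normed volume) (ContinuousLinearMap.lsmul ℝ ℝ : ℝ →L[ℝ] R3 →L[ℝ] R3)
    (g := fun (s : ℝ) (x : R3) => a (s, x)) (s := univ) (k := Prod.snd '' tsupport a)
    isOpen_univ (hac.isCompact.image continuous_snd)
    (fun p x _ hx => by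
      by_contra h
      exact hx ⟨(p, x), subset_tsupport _ h, rfl⟩)
    ρ.integrable_normed.locallyIntegrable ha.contDiffOn
  rw [univ_prod_univ, contDiffOn_univ] at h
  simp_rw [mollify_eq_convolution]
  exact h

/-- The substitution `τ = s r` moves the variable endpoint into the integrand: `∫₀ˢ b(τ,x) dτ = ∫₀¹
s b(s r, x) dr`. This is the value at `0` of a convolution of the indicator of `(0,1]` with a kernel
depending smoothly on the parameter `(s,x)`; the bump `c`, equal to `1` on `[-1,1]`, only makes that
kernel compactly supported. -/
theorem contDiff_parametric_primitive {b : ℝ × R3 → R3} (hb : ContDiff ℝ ∞ b) :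
    ContDiff ℝ ∞ fun y : ℝ × R3 => ∫ τ in (0)..y.1, b (τ, y.2) := by
  set c : ContDiffBump (0 : ℝ) := ⟨1, 2, by norm_num, by norm_num⟩ with hc
  have h := contDiffOn_convolution_right_with_param_comp (𝕜 := ℝ) (n := ⊤)
    (μ := (volume : Measure ℝ)) (f := indicator (Ioc (0 : ℝ) 1) (fun _ => (1 : ℝ)))
    (ContinuousLinearMap.lsmul ℝ ℝ : ℝ →L[ℝ] R3 →L[ℝ] R3)
    (v := fun _ : ℝ × R3 => (0 : ℝ)) (s := univ) contDiffOn_const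
    (g := fun (y : ℝ × R3) (r : ℝ) => c r • y.1 • b (-(y.1 * r), y.2))
    (k := Metric.closedBall 0 2) isOpen_univ (isCompact_closedBall _ _)
    (fun p x _ hx => by
      have : c x = 0 := by
        apply c.zero_of_le_dist
        simp only [Metric.mem_closedBall, not_le] at hx
        exact hx.le
      simp [this])
    ((locallyIntegrable_const (1 : ℝ)).indicator measurableSet_Ioc)
    (by
      refine ContDiff.contDiffOn ?_
      have h1 : ContDiff ℝ ∞ fun q : (ℝ × R3) × ℝ => c q.2 := c.contDiff.comp contDiff_snd
      have h2 : ContDiff ℝ ∞ fun q : (ℝ × R3) × ℝ => b (-(q.1.1 * q.2), q.1.2) :=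
        hb.comp (by fun_prop)
      have h3 : ContDiff ℝ ∞ fun q : (ℝ × R3) × ℝ => q.1.1 := by fun_prop
      exact h1.smul (h3.smul h2))
  rw [contDiffOn_univ] at h
  convert h using 1
  ext1 y
  rw [convolution_def]
  simp only [ContinuousLinearMap.lsmul_apply, zero_sub, mul_neg, neg_neg]
  have h1 : ∀ r : ℝ, indicator (Ioc (0 : ℝ) 1) (fun _ => (1 : ℝ)) r •
      c (-r) • y.1 • b (y.1 * r, y.2) =
      indicator (Ioc (0 : ℝ) 1) (fun r => y.1 • b (y.1 * r, y.2)) r := by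
    intro r
    by_cases hr : r ∈ Ioc (0 : ℝ) 1
    · have : c (-r) = 1 := by
        apply c.one_of_mem_closedBall
        simp only [hc, Metric.mem_closedBall, dist_zero_right, norm_neg, Real.norm_eq_abs]
        rw [abs_of_pos hr.1]
        exact hr.2
      simp [hr, this]
    · simp [hr]
  simp_rw [h1]
  rw [integral_indicator measurableSet_Ioc, ← intervalIntegral.integral_of_le zero_le_one,
    intervalIntegral.integral_smul, intervalIntegral.smul_integral_comp_mul_left
      (f := fun r => b (r, y.2))]
  simp

/-- The test function `c(s) η(x)` is compactly supported in space-time, while `c = 1` near `[0,t]`,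
so its time derivative vanishes there. -/
theorem IsWeakTimeDeriv.integral_smul_sub {T : ℝ} {u ut : ℝ → R3 → R3}
    (hut : IsWeakTimeDeriv T u ut) {η : R3 → ℝ} (hη : ContDiff ℝ ∞ η) (hηc : HasCompactSupport η)
    {t : ℝ} (ht : t ∈ Icc 0 T) :
    (∫ x, η x • u t x) - ∫ x, η x • u 0 x = ∫ s in (0)..t, ∫ x, η x • ut s x := by
  set c : ContDiffBump (0 : ℝ) := ⟨|t| + 1, |t| + 2, by positivity, by linarith⟩ with hc
  have hc1 : ∀ s ∈ Icc 0 t, c =ᶠ[𝓝 s] fun _ => 1 := by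
    intro s hs
    apply c.eventuallyEq_one_of_mem_ball
    simp only [hc, Metric.mem_ball, dist_zero_right, Real.norm_eq_abs]
    rw [abs_of_nonneg hs.1]
    linarith [hs.2, le_abs_self t]
  have hψ : ContDiff ℝ ∞ fun y : ℝ × R3 => c y.1 * η y.2 :=
    (c.contDiff.comp contDiff_fst).mul (hη.comp contDiff_snd)
  have hψc : HasCompactSupport fun y : ℝ × R3 => c y.1 * η y.2 := by
    refine HasCompactSupport.intro (c.hasCompactSupport.isCompact.prod hηc.isCompact) ?_
    intro y hy
    by_contra h
    exact hy ⟨subset_tsupport _ (left_ne_zero_of_mul h), subset_tsupport _ (right_ne_zero_of_mul h)⟩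
  have h := hut.weak_eq _ hψ hψc t ht
  simp only at h
  rw [(hc1 t ⟨ht.1, le_rfl⟩).eq_of_nhds, (hc1 0 ⟨le_rfl, ht.1⟩).eq_of_nhds] at h
  simp only [one_mul] at h
  rw [h]
  refine intervalIntegral.integral_congr fun s hs => ?_
  rw [uIcc_of_le ht.1] at hs
  refine integral_congr_ae (Eventually.of_forall fun x => ?_)
  have h1 : fderiv ℝ (fun y : ℝ × R3 => c y.1 * η y.2) (s, x) (1, 0) = 0 := by
    have h2 : HasFDerivAt (fun y : ℝ × R3 => c y.1 * η y.2)
        ((fderiv ℝ η x).comp (ContinuousLinearMap.snd ℝ ℝ R3)) (s, x) := by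
      have h3 : HasFDerivAt (fun y : ℝ × R3 => η y.2)
          ((fderiv ℝ η x).comp (ContinuousLinearMap.snd ℝ ℝ R3)) (s, x) :=
        ((hη.differentiable (by simp)) x).hasFDerivAt.comp (s, x) hasFDerivAt_snd
      refine h3.congr_of_eventuallyEq ?_
      have := (continuous_fst.tendsto (s, x)).eventually (hc1 s hs)
      filter_upwards [this] with y hy
      rw [hy, one_mul]
    rw [h2.fderiv]
    simp
  simp only [h1, zero_smul, zero_add]
  rw [(hc1 s hs).eq_of_nhds, one_mul]

theorem IsWeakTimeDeriv.integrable_deriv_prod_ball {T : ℝ} {u ut : ℝ → R3 → R3}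
    (hut : IsWeakTimeDeriv T u ut) (R : ℝ) :
    Integrable (fun y : ℝ × R3 => ut y.1 y.2)
      ((volume.restrict (Ioc 0 T)).prod (volume.restrict (Metric.ball 0 R))) := by
  have h := hut.locallyIntegrable_deriv.integrableOn_compact_subset
    (t := Icc 0 T ×ˢ Metric.closedBall 0 R) (prod_mono_right (subset_univ _))
    (isCompact_Icc.prod (isCompact_closedBall 0 R))
  rw [Measure.prod_restrict]
  exact h.mono_set (prod_mono Ioc_subset_Icc_self Metric.ball_subset_closedBall)

theorem integrable_prod_of_lintegral_eLpNorm_lt_top {E : Type*} [NormedAddCommGroup E] {T : ℝ}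
    {F : ℝ → R3 → E}
    (hF : AEStronglyMeasurable (fun y : ℝ × R3 => F y.1 y.2)
      ((volume.restrict (Ioc 0 T)).prod volume))
    (hF' : ∫⁻ s in Ioc 0 T, eLpNorm (F s) ⊤ volume < ⊤) (R : ℝ) :
    Integrable (fun y : ℝ × R3 => F y.1 y.2)
      ((volume.restrict (Ioc 0 T)).prod (volume.restrict (Metric.ball 0 R))) := by
  have hm : AEStronglyMeasurable (fun y : ℝ × R3 => F y.1 y.2)
      ((volume.restrict (Ioc 0 T)).prod (volume.restrict (Metric.ball 0 R))) :=
    hF.mono_ac (Measure.AbsolutelyContinuous.rfl.prod Measure.restrict_le_self.absolutelyContinuous)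
  refine ⟨hm, ?_⟩
  rw [hasFiniteIntegral_iff_enorm, lintegral_prod _ hm.enorm]
  calc _ ≤ ∫⁻ s in Ioc 0 T, eLpNorm (F s) ⊤ volume * volume (Metric.ball (0 : R3) R) := by
        refine lintegral_mono fun s => ?_
        calc _ ≤ ∫⁻ _ in Metric.ball (0 : R3) R, eLpNorm (F s) ⊤ volume := by
              refine lintegral_mono_ae (ae_restrict_of_ae ?_)
              rw [eLpNorm_exponent_top]
              exact ae_le_eLpNormEssSup
          _ = _ := by rw [lintegral_const, Measure.restrict_apply_univ]
    _ < ⊤ := by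
        rw [lintegral_mul_const' _ _ measure_ball_lt_top.ne]
        exact ENNReal.mul_lt_top hF' measure_ball_lt_top

theorem IsL1Lipschitz.integrable_prod_ball {T : ℝ} {u : ℝ → R3 → R3} {Du : ℝ → R3 → R3 →L[ℝ] R3}
    (hu : IsL1Lipschitz T u Du) (R : ℝ) :
    Integrable (fun y : ℝ × R3 => u y.1 y.2)
      ((volume.restrict (Ioc 0 T)).prod (volume.restrict (Metric.ball 0 R))) :=
  integrable_prod_of_lintegral_eLpNorm_lt_top hu.aestronglyMeasurable
    (lt_of_le_of_lt (lintegral_mono fun _ => le_self_add) hu.norm_lt_top) R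

theorem IsL1Lipschitz.integrable_grad_prod_ball {T : ℝ} {u : ℝ → R3 → R3}
    {Du : ℝ → R3 → R3 →L[ℝ] R3} (hu : IsL1Lipschitz T u Du) (R : ℝ) :
    Integrable (fun y : ℝ × R3 => Du y.1 y.2)
      ((volume.restrict (Ioc 0 T)).prod (volume.restrict (Metric.ball 0 R))) :=
  integrable_prod_of_lintegral_eLpNorm_lt_top hu.aestronglyMeasurable_grad
    (lt_of_le_of_lt (lintegral_mono fun _ => le_add_self) hu.norm_lt_top) R

/-- The derivative falls on the kernel, and `y ↦ ρ(x - y)` is itself a test function; the sign from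
the reflection cancels the one in the weak formulation. -/
theorem IsWeakGradient.fderiv_mollify {w : R3 → R3} {G : R3 → R3 →L[ℝ] R3}
    (h : IsWeakGradient w G) (ρ : ContDiffBump (0 : R3)) (x : R3) :
    fderiv ℝ (mollify ρ w) x = mollify ρ G x := by
  obtain ⟨hw, hG, h⟩ := h
  have hρ1 : ContDiff ℝ 1 (ρ.normed (volume : Measure R3)) := ρ.contDiff_normed (n := 1)
  have hd := (ρ.hasCompactSupport_normed (μ := volume)).hasFDerivAt_convolution_left
    (ContinuousLinearMap.lsmul ℝ ℝ : ℝ →L[ℝ] R3 →L[ℝ] R3) hρ1 hw x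
  rw [← mollify_eq_convolution] at hd
  rw [hd.fderiv]
  ext1 e
  have hψ : ContDiff ℝ ∞ fun y => ρ.normed volume (x - y) :=
    (ρ.contDiff_normed (n := ⊤)).comp (by fun_prop)
  have hψc : HasCompactSupport fun y => ρ.normed volume (x - y) :=
    (ρ.hasCompactSupport_normed (μ := volume)).comp_homeomorph (Homeomorph.subLeft x)
  have h1 := h _ hψ hψc e
  have hIG : Integrable fun y => ρ.normed volume (x - y) • G y :=
    hG.integrable_smul_left_of_hasCompactSupport hψ.continuous hψc
  have h2 : mollify ρ G x e = ∫ y, ρ.normed volume (x - y) • G y e := by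
    unfold mollify
    rw [ContinuousLinearMap.integral_apply hIG]
    rfl
  have hex : ConvolutionExistsAt (fderiv ℝ (ρ.normed volume)) w x
      ((ContinuousLinearMap.lsmul ℝ ℝ : ℝ →L[ℝ] R3 →L[ℝ] R3).precompL R3) volume :=
    (ρ.hasCompactSupport_normed.fderiv ℝ).convolutionExists_left _
      (hρ1.continuous_fderiv one_ne_zero) hw x
  rw [convolution_eq_swap, ContinuousLinearMap.integral_apply hex.integrable_swap, h2,
    ← neg_inj, ← h1, ← integral_neg]
  refine integral_congr_ae (Eventually.of_forall fun y => ?_)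
  have h3 : fderiv ℝ (fun y => ρ.normed volume (x - y)) y e =
      - fderiv ℝ (ρ.normed volume) (x - y) e := by
    have h4 : HasFDerivAt (fun y => ρ.normed volume (x - y))
        ((fderiv ℝ (ρ.normed volume) (x - y)).comp (-ContinuousLinearMap.id ℝ R3)) y :=
      ((hρ1.differentiable one_ne_zero) (x - y)).hasFDerivAt.comp y
        ((hasFDerivAt_id y).const_sub x)
    rw [h4.fderiv]
    simp
  simp only [h3, neg_smul]
  rfl

/-! ### Smooth space-time approximation of the velocity field. -/

theorem integral_integral_kernel_smul {s R : ℝ} (hs : 0 ≤ s) {a : ℝ → R3 → R3}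
    {κ : R3 → ℝ} (hκ0 : ∀ y ∉ Metric.ball (0 : R3) R, κ y = 0)
    (ha : Integrable (fun z : ℝ × R3 => κ z.2 • a z.1 z.2)
      ((volume.restrict (Ioc 0 s)).prod (volume.restrict (Metric.ball 0 R)))) :
    ∫ τ in (0)..s, ∫ y, κ y • a τ y = ∫ z, κ z.2 • a z.1 z.2
      ∂((volume.restrict (Ioc 0 s)).prod (volume.restrict (Metric.ball 0 R))) := by
  rw [intervalIntegral.integral_of_le hs, integral_prod _ ha]
  refine integral_congr_ae (Eventually.of_forall fun τ => ?_)
  refine (setIntegral_eq_integral_of_forall_compl_eq_zero fun y hy => ?_).symm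
  rw [hκ0 y hy, zero_smul]

/-- The bound does not depend on `s`: this is how `L¹` closeness of time derivatives becomes
closeness at every single time. -/
theorem norm_integral_kernel_sub_le {T R : ℝ} {a b : ℝ → R3 → R3}
    (ha : Integrable (fun z : ℝ × R3 => a z.1 z.2)
      ((volume.restrict (Ioc 0 T)).prod (volume.restrict (Metric.ball 0 R))))
    (hb : Integrable (fun z : ℝ × R3 => b z.1 z.2)
      ((volume.restrict (Ioc 0 T)).prod (volume.restrict (Metric.ball 0 R))))
    {κ : R3 → ℝ} (hκc : Continuous κ) {C : ℝ} (hC : ∀ y, ‖κ y‖ ≤ C)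
    (hκ0 : ∀ y ∉ Metric.ball (0 : R3) R, κ y = 0) {s : ℝ} (hs : s ∈ Icc 0 T) {ε : ℝ} (hε0 : 0 ≤ ε)
    (hε : ∫⁻ z, ‖a z.1 z.2 - b z.1 z.2‖ₑ
      ∂((volume.restrict (Ioc 0 T)).prod (volume.restrict (Metric.ball 0 R))) ≤
        ENNReal.ofReal ε) :
    ‖(∫ τ in (0)..s, ∫ y, κ y • a τ y) - ∫ τ in (0)..s, ∫ y, κ y • b τ y‖ ≤ C * ε := by
  have hC0 : 0 ≤ C := (norm_nonneg _).trans (hC 0)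
  set ν := (volume.restrict (Ioc 0 T)).prod (volume.restrict (Metric.ball (0 : R3) R)) with hν
  set ν' := (volume.restrict (Ioc 0 s)).prod (volume.restrict (Metric.ball (0 : R3) R)) with hν'
  have hle : ν' ≤ ν := by
    rw [hν, hν', Measure.prod_restrict, Measure.prod_restrict]
    exact Measure.restrict_mono (prod_mono_left (Ioc_subset_Ioc_right hs.2)) le_rfl
  have hm : AEStronglyMeasurable (fun z : ℝ × R3 => κ z.2) ν' :=
    (hκc.comp continuous_snd).aestronglyMeasurable
  have hka : Integrable (fun z : ℝ × R3 => κ z.2 • a z.1 z.2) ν' :=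
    (ha.mono_measure hle).bdd_smul C hm (Eventually.of_forall fun z => hC _)
  have hkb : Integrable (fun z : ℝ × R3 => κ z.2 • b z.1 z.2) ν' :=
    (hb.mono_measure hle).bdd_smul C hm (Eventually.of_forall fun z => hC _)
  rw [integral_integral_kernel_smul hs.1 hκ0 hka, integral_integral_kernel_smul hs.1 hκ0 hkb,
    ← integral_sub hka hkb]
  have hab : Integrable (fun z : ℝ × R3 => a z.1 z.2 - b z.1 z.2) ν := ha.sub hb
  calc _ ≤ ∫ z, C * ‖a z.1 z.2 - b z.1 z.2‖ ∂ν' := by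
        refine norm_integral_le_of_norm_le ((hab.mono_measure hle).norm.const_mul C) ?_
        refine Eventually.of_forall fun z => ?_
        rw [← smul_sub, norm_smul]
        gcongr
        exact hC _
    _ = C * ∫ z, ‖a z.1 z.2 - b z.1 z.2‖ ∂ν' := integral_const_mul _ _
    _ ≤ C * ∫ z, ‖a z.1 z.2 - b z.1 z.2‖ ∂ν := by
        gcongr
        · exact Eventually.of_forall fun z => norm_nonneg _
        · exact hab.norm
    _ ≤ C * ε := by
        gcongr
        rw [integral_norm_eq_lintegral_enorm hab.1]
        exact ENNReal.toReal_le_of_le_ofReal hε0 hε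

theorem fderiv_parametric_primitive_apply {b : ℝ × R3 → R3} (hb : ContDiff ℝ ∞ b) (s : ℝ) (x : R3) :
    fderiv ℝ (fun y : ℝ × R3 => ∫ τ in (0)..y.1, b (τ, y.2)) (s, x) (1, 0) = b (s, x) := by
  have h1 : DifferentiableAt ℝ (fun y : ℝ × R3 => ∫ τ in (0)..y.1, b (τ, y.2)) (s, x) :=
    (contDiff_parametric_primitive hb).differentiable (by simp) _
  have hline : HasDerivAt (fun r : ℝ => ((r, x) : ℝ × R3)) (1, 0) s :=
    (hasDerivAt_id s).prodMk (hasDerivAt_const s x)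
  have h2 := h1.hasFDerivAt.comp_hasDerivAt s hline
  have h3 : HasDerivAt (fun r => ∫ τ in (0)..r, b (τ, x)) (b (s, x)) s := by
    have hc : Continuous fun τ => b (τ, x) := hb.continuous.comp (by fun_prop)
    exact hc.integral_hasStrictDerivAt 0 s |>.hasDerivAt
  exact h2.unique h3

/-- Mollification in `x` alone does not smooth in time. Since `ρ*u(s) = ρ*u(0) + ∫₀ˢ ρ*ut`, one
replaces `ut` by a smooth `L¹`-close `a` and takes `U(s) = ρ*u(0) + ∫₀ˢ ρ*a`. The error `∫₀ˢ ρ*(a -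
ut)` and its spatial gradient are then uniformly small in `s`, because the kernel is bounded and
Lipschitz. -/
theorem exists_contDiff_approx_mollify {T : ℝ} {u ut : ℝ → R3 → R3}
    (hut : IsWeakTimeDeriv T u ut) {ρ : ContDiffBump (0 : R3)} (hρ : ρ.rOut ≤ 1) (hT : 0 ≤ T)
    (R : ℝ) {ε : ℝ} (hε : 0 < ε) :
    ∃ U : ℝ × R3 → R3, ContDiff ℝ ∞ U ∧
      (∀ s ∈ Icc 0 T, ∀ x ∈ Metric.ball (0 : R3) R, ‖U (s, x) - mollify ρ (u s) x‖ ≤ ε) ∧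
      (∀ s ∈ Icc 0 T, ∀ x ∈ Metric.ball (0 : R3) R,
        ‖fderiv ℝ (fun x => U (s, x)) x - fderiv ℝ (mollify ρ (u s)) x‖ ≤ ε) ∧
      ∫⁻ s in Ioc 0 T, ∫⁻ x in Metric.ball 0 R,
        ‖fderiv ℝ U (s, x) (1, 0) - mollify ρ (ut s) x‖ₑ ≤ ENNReal.ofReal ε := by
  obtain ⟨C, hC⟩ := ρ.hasCompactSupport_normed.exists_bound_of_continuous
      (ρ.continuous_normed (μ := volume))
  have hC0 : 0 ≤ C := (norm_nonneg _).trans (hC 0)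
  have hρ1 : ContDiff ℝ ∞ (ρ.normed (volume : Measure R3)) := ρ.contDiff_normed (n := ⊤)
  obtain ⟨L, hL⟩ := ContDiff.lipschitzWith_of_hasCompactSupport
    (ρ.hasCompactSupport_normed (μ := volume)) hρ1 (by simp)
  -- The time derivative, the values and the gradient lose the factors `1`, `C` (bound of the
  -- kernel) and `L` (its Lipschitz constant).
  set ε' : ℝ := ε / (1 + C + L) with hε'
  have hε'0 : 0 < ε' := by positivity
  have hε'1 : ε' ≤ ε := div_le_self hε.le (by linarith [L.2])
  have hε'C : C * ε' ≤ ε := by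
    rw [hε', mul_div_assoc', div_le_iff₀ (by positivity)]
    nlinarith [L.2, mul_nonneg hε.le L.2]
  have hε'L : L * ε' ≤ ε := by
    rw [hε', mul_div_assoc', div_le_iff₀ (by positivity)]
    nlinarith [L.2, mul_nonneg hε.le hC0]
  have hutI := hut.integrable_deriv_prod_ball (R + 1)
  obtain ⟨a, ha1, ha2, ha3⟩ := (memLp_one_iff_integrable.2 hutI).exist_eLpNorm_sub_le
    ENNReal.one_ne_top le_rfl hε'0
  rw [eLpNorm_one_eq_lintegral_enorm] at ha3
  have haI : Integrable (fun y : ℝ × R3 => a (y.1, y.2))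
      ((volume.restrict (Ioc 0 T)).prod (volume.restrict (Metric.ball 0 (R + 1)))) :=
    ha2.continuous.integrable_of_hasCompactSupport ha1
  have ha4 : ∫⁻ z, ‖a (z.1, z.2) - ut z.1 z.2‖ₑ
      ∂((volume.restrict (Ioc 0 T)).prod (volume.restrict (Metric.ball 0 (R + 1)))) ≤
        ENNReal.ofReal ε' := by
    refine le_trans (le_of_eq (lintegral_congr fun z => ?_)) ha3
    rw [← enorm_neg]
    simp
  set b : ℝ × R3 → R3 := fun y => mollify ρ (fun x => a (y.1, x)) y.2 with hb
  have hbs : ContDiff ℝ ∞ b := contDiff_mollify_param ρ ha2 ha1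
  have hu0 : LocallyIntegrable (u 0) := hut.locallyIntegrable 0 ⟨le_rfl, hT⟩
  have hm0 : ContDiff ℝ ∞ fun y : ℝ × R3 => mollify ρ (u 0) y.2 :=
    (contDiff_mollify ρ hu0).comp contDiff_snd
  set U : ℝ × R3 → R3 := fun y => mollify ρ (u 0) y.2 + ∫ τ in (0)..y.1, b (τ, y.2) with hU
  have hUs : ContDiff ℝ ∞ U := hm0.add (contDiff_parametric_primitive hbs)
  have hdiff : ∀ s ∈ Icc 0 T, ∀ x, U (s, x) - mollify ρ (u s) x =
      (∫ τ in (0)..s, ∫ y, ρ.normed volume (x - y) • a (τ, y)) -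
        ∫ τ in (0)..s, ∫ y, ρ.normed volume (x - y) • ut τ y := by
    intro s hs x
    rw [← hut.integral_smul_sub (η := fun y => ρ.normed volume (x - y))
      (hρ1.comp (by fun_prop)) ((ρ.hasCompactSupport_normed (μ := volume)).comp_homeomorph
        (Homeomorph.subLeft x)) hs]
    simp only [hU, hb, mollify]
    abel
  have hcont : ∀ x : R3, Continuous fun y : R3 => ρ.normed volume (x - y) := fun x =>
    hρ1.continuous.comp (by fun_prop)
  refine ⟨U, hUs, ?_, ?_, ?_⟩
  · intro s hs x hx
    rw [hdiff s hs x]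
    exact (norm_integral_kernel_sub_le (a := fun s x => a (s, x)) haI hutI (hcont x)
      (fun y => hC _) (fun y hy => normed_sub_eq_zero hρ hx hy) hs hε'0.le ha4).trans hε'C
  · intro s hs x hx
    -- The gradient is bounded through a Lipschitz estimate, that is, the same integral bound with
    -- the difference of two translated kernels; no differentiation under the integral is needed.
    have hlip : LipschitzOnWith (Real.toNNReal ε) (fun x => U (s, x) - mollify ρ (u s) x)
        (Metric.ball 0 R) := by
      refine LipschitzOnWith.of_dist_le_mul fun x' hx' x'' hx'' => ?_
      rw [dist_eq_norm, hdiff s hs, hdiff s hs, Real.coe_toNNReal _ hε.le]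
      have hI : ∀ (c : ℝ → R3 → R3), Integrable (fun z : ℝ × R3 => c z.1 z.2)
          ((volume.restrict (Ioc 0 T)).prod (volume.restrict (Metric.ball 0 (R + 1)))) →
          ∀ x' ∈ Metric.ball (0 : R3) R, ∀ x'' ∈ Metric.ball (0 : R3) R,
          (∫ τ in (0)..s, ∫ y, ρ.normed volume (x' - y) • c τ y) -
            (∫ τ in (0)..s, ∫ y, ρ.normed volume (x'' - y) • c τ y) =
          ∫ τ in (0)..s, ∫ y, (ρ.normed volume (x' - y) - ρ.normed volume (x'' - y)) • c τ y := by
        intro c hc x' hx' x'' hx''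
        have hle : (volume.restrict (Ioc 0 s)).prod (volume.restrict (Metric.ball (0 : R3) (R + 1)))
            ≤ (volume.restrict (Ioc 0 T)).prod (volume.restrict (Metric.ball (0 : R3) (R + 1))) := by
          rw [Measure.prod_restrict, Measure.prod_restrict]
          exact Measure.restrict_mono (prod_mono_left (Ioc_subset_Ioc_right hs.2)) le_rfl
        have hk : ∀ x : R3, Integrable (fun z : ℝ × R3 => ρ.normed volume (x - z.2) • c z.1 z.2)
            ((volume.restrict (Ioc 0 s)).prod (volume.restrict (Metric.ball 0 (R + 1)))) :=
          fun x => (hc.mono_measure hle).bdd_smul C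
            ((hcont x).comp continuous_snd).aestronglyMeasurable
            (Eventually.of_forall fun z => hC _)
        rw [integral_integral_kernel_smul hs.1 (fun y hy => normed_sub_eq_zero hρ hx' hy) (hk x'),
          integral_integral_kernel_smul hs.1 (fun y hy => normed_sub_eq_zero hρ hx'' hy) (hk x''),
          integral_integral_kernel_smul hs.1
            (κ := fun y => ρ.normed volume (x' - y) - ρ.normed volume (x'' - y))
            (fun y hy => by
              rw [normed_sub_eq_zero hρ hx' hy, normed_sub_eq_zero hρ hx'' hy, sub_zero])
            (by simp_rw [sub_smul]; exact (hk x').sub (hk x'')),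
          ← integral_sub (hk x') (hk x'')]
        simp_rw [sub_smul]
      rw [sub_sub_sub_comm, hI (fun s x => a (s, x)) haI x' hx' x'' hx'',
        hI ut hutI x' hx' x'' hx'']
      refine (norm_integral_kernel_sub_le (a := fun s x => a (s, x)) haI hutI
        (κ := fun y => ρ.normed volume (x' - y) - ρ.normed volume (x'' - y))
        ((hcont x').sub (hcont x'')) (C := L * dist x' x'')
        (fun y => ?_) (fun y hy => ?_) hs hε'0.le ha4).trans ?_
      · rw [← dist_eq_norm]
        refine (hL.dist_le_mul _ _).trans (le_of_eq ?_)
        rw [dist_sub_right]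
      · rw [normed_sub_eq_zero hρ hx' hy, normed_sub_eq_zero hρ hx'' hy, sub_zero]
      · rw [mul_right_comm]
        gcongr
    have h1 := norm_fderiv_le_of_lipschitzOn ℝ (Metric.isOpen_ball.mem_nhds hx) hlip
    rw [Real.coe_toNNReal _ hε.le, fderiv_fun_sub] at h1
    · exact h1
    · exact (hUs.differentiable (by simp) _).comp x (by fun_prop)
    · exact (contDiff_mollify ρ (hut.locallyIntegrable s hs)).differentiable (by simp) _
  · have hder : ∀ s x, fderiv ℝ U (s, x) (1, 0) = b (s, x) := by
      intro s x
      rw [hU, fderiv_fun_add (hm0.differentiable (by simp) _)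
        ((contDiff_parametric_primitive hbs).differentiable (by simp) _),
        add_apply, fderiv_parametric_primitive_apply hbs]
      have : fderiv ℝ (fun y : ℝ × R3 => mollify ρ (u 0) y.2) (s, x) (1, 0) = 0 := by
        have h := ((contDiff_mollify ρ hu0).differentiable (by simp) x).hasFDerivAt.comp
          (s, x) (hasFDerivAt_snd (𝕜 := ℝ) (p := (s, x)))
        rw [show (fun y : ℝ × R3 => mollify ρ (u 0) y.2) = mollify ρ (u 0) ∘ Prod.snd from rfl,
          h.fderiv]
        simp
      rw [this, zero_add]
    have haem : AEStronglyMeasurable (fun z : ℝ × R3 => a (z.1, z.2) - ut z.1 z.2)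
      ((volume.restrict (Ioc 0 T)).prod (volume.restrict (Metric.ball 0 (R + 1)))) :=
      haI.1.sub hutI.1
    rw [lintegral_prod _ haem.enorm] at ha4
    refine le_trans (lintegral_mono_ae ?_) (ha4.trans (ENNReal.ofReal_le_ofReal hε'1))
    filter_upwards [haI.prod_right_ae, hutI.prod_right_ae] with s hs1 hs2
    refine le_trans ?_ (lintegral_enorm_mollify_le hρ R (hs1.1.sub hs2.1))
    refine setLIntegral_mono' measurableSet_ball fun x hx => le_of_eq ?_
    rw [hder]
    congr 1
    simp only [hb, mollify]
    rw [← integral_sub (integrable_normed_sub_smul hρ hx hs1)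
      (integrable_normed_sub_smul hρ hx hs2)]
    simp_rw [← smul_sub]

theorem lintegral_lintegral_enorm_sub_le {α β E : Type*} [MeasurableSpace α] [MeasurableSpace β]
    [NormedAddCommGroup E] {μ : Measure α} {ν : Measure β} [SFinite μ] [SFinite ν]
    {A B C : α → β → E}
    (hBC : AEStronglyMeasurable (fun y : α × β => B y.1 y.2 - C y.1 y.2) (μ.prod ν)) :
    ∫⁻ s, (∫⁻ x, ‖A s x - C s x‖ₑ ∂ν) ∂μ ≤
      ∫⁻ s, (∫⁻ x, ‖A s x - B s x‖ₑ ∂ν) ∂μ + ∫⁻ s, (∫⁻ x, ‖B s x - C s x‖ₑ ∂ν) ∂μ := by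
  rw [← lintegral_add_right' _ hBC.enorm.lintegral_prod_right']
  refine lintegral_mono_ae ?_
  filter_upwards [hBC.prodMk_left] with s hs
  rw [← lintegral_add_right' _ hs.enorm]
  refine lintegral_mono fun x => ?_
  have : A s x - C s x = (A s x - B s x) + (B s x - C s x) := by abel
  rw [this]
  exact enorm_add_le _ _

theorem quasiMeasurePreserving_fst_fst {α β γ : Type*} [MeasurableSpace α] [MeasurableSpace β]
    [MeasurableSpace γ] (μ : Measure α) (ν : Measure β) (ν' : Measure γ) [SFinite μ] [SFinite ν]
    [SFinite ν'] :
    Measure.QuasiMeasurePreserving (fun y : α × (β × γ) => (y.1, y.2.1))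
      (μ.prod (ν.prod ν')) (μ.prod ν) :=
  MeasureTheory.QuasiMeasurePreserving.prodMap (Measure.QuasiMeasurePreserving.id μ)
    Measure.quasiMeasurePreserving_fst

theorem aestronglyMeasurable_clm_apply {α E F : Type*} [MeasurableSpace α] {μ : Measure α}
    [NormedAddCommGroup E] [NormedSpace ℝ E] [NormedAddCommGroup F] [NormedSpace ℝ F]
    {L : α → E →L[ℝ] F} {e : α → E} (hL : AEStronglyMeasurable L μ)
    (he : AEStronglyMeasurable e μ) : AEStronglyMeasurable (fun y => L y (e y)) μ :=
  (ContinuousLinearMap.id ℝ (E →L[ℝ] F)).aestronglyMeasurable_comp₂ hL he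

theorem IsWeakTimeDeriv.aestronglyMeasurable_deriv {T : ℝ} {u ut : ℝ → R3 → R3}
    (hut : IsWeakTimeDeriv T u ut) :
    AEStronglyMeasurable (fun y : ℝ × R3 => ut y.1 y.2)
      ((volume.restrict (Ioc 0 T)).prod volume) := by
  have h := hut.locallyIntegrable_deriv.aestronglyMeasurable
  rw [← Measure.restrict_univ (μ := (volume : Measure R3)), Measure.prod_restrict]
  exact h.mono_measure (Measure.restrict_mono (prod_mono_left Ioc_subset_Icc_self) le_rfl)

/-- Smooth space-time approximation of `u` at scale `ε` on the ball of radius `R`. -/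
theorem exists_contDiff_approx {T : ℝ} {u ut : ℝ → R3 → R3} {Du : ℝ → R3 → R3 →L[ℝ] R3}
    (hT : 0 ≤ T) (hu : IsL1Lipschitz T u Du) (hut : IsWeakTimeDeriv T u ut)
    (R : ℝ) {ε : ℝ} (hε : 0 < ε) :
    ∃ (U : ℝ × R3 → R3) (ρ : ContDiffBump (0 : R3)), ContDiff ℝ ∞ U ∧
      ρ.rOut ≤ ε ∧ ρ.rOut ≤ 2 * ρ.rIn ∧
      (∀ s ∈ Icc 0 T, ∀ x ∈ Metric.ball (0 : R3) R, ‖U (s, x) - mollify ρ (u s) x‖ ≤ ε) ∧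
      ∫⁻ s in Ioc 0 T, (∫⁻ x in Metric.ball 0 R,
        ‖fderiv ℝ U (s, x) (1, 0) - ut s x‖ₑ) ≤ ENNReal.ofReal ε ∧
      ∫⁻ s in Ioc 0 T, (∫⁻ x in Metric.ball 0 R,
        ‖fderiv ℝ (fun x => U (s, x)) x - Du s x‖ₑ) ≤ ENNReal.ofReal ε := by
  obtain ⟨δ₁, hδ₁, h₁⟩ := exists_forall_lintegral_mollify_sub_le
    (hut.integrable_deriv_prod_ball (R + 1)) (half_pos hε)
  obtain ⟨δ₂, hδ₂, h₂⟩ := exists_forall_lintegral_mollify_sub_le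
    (hu.integrable_grad_prod_ball (R + 1)) (half_pos hε)
  set r : ℝ := min (min δ₁ δ₂) (min ε 1) with hr
  have hr0 : 0 < r := by positivity
  -- The ratio `2` between the radii stays fixed as `r → 0`, as the Lebesgue differentiation
  -- argument for almost everywhere convergence requires.
  set ρ : ContDiffBump (0 : R3) := ⟨r / 2, r, half_pos hr0, half_lt_self hr0⟩ with hρ
  have hρr : ρ.rOut = r := rfl
  have hρ1 : ρ.rOut ≤ 1 := (min_le_right _ _).trans (min_le_right _ _)
  set V : ℝ := (volume (Metric.ball (0 : R3) R)).toReal with hV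
  have hV0 : 0 ≤ V := ENNReal.toReal_nonneg
  -- The gradient error is uniform and gets integrated over a set of measure `T * V`; the result
  -- must stay below `ε/2`.
  set ε' : ℝ := min ε (ε / (2 * (1 + T * V))) with hε'
  have hTV : 0 ≤ T * V := mul_nonneg hT hV0
  have hε'0 : 0 < ε' := by positivity
  have hε'2 : ε' ≤ ε / 2 := (min_le_right _ _).trans (by
    rw [div_le_div_iff₀ (by positivity) (by norm_num)]
    nlinarith)
  obtain ⟨U, hU, hU0, hU1, hU2⟩ := exists_contDiff_approx_mollify hut hρ1 hT R hε'0
  have hac : ((volume.restrict (Ioc 0 T)).prod (volume.restrict (Metric.ball (0 : R3) R))) ≪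
      ((volume.restrict (Ioc 0 T)).prod volume) :=
    Measure.AbsolutelyContinuous.rfl.prod Measure.restrict_le_self.absolutelyContinuous
  refine ⟨U, ρ, hU, (min_le_right _ _).trans (min_le_left _ _), ?_, ?_, ?_, ?_⟩
  · rw [hρ]
    simp only
    linarith
  · intro s hs x hx
    exact (hU0 s hs x hx).trans (min_le_left _ _)
  · refine (lintegral_lintegral_enorm_sub_le (B := fun s x => mollify ρ (ut s) x) ?_).trans ?_
    · exact ((aestronglyMeasurable_mollify_prod ρ hut.aestronglyMeasurable_deriv).sub
        hut.aestronglyMeasurable_deriv).mono_ac hac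
    · rw [← add_halves ε, ENNReal.ofReal_add (by positivity) (by positivity)]
      refine add_le_add (hU2.trans (ENNReal.ofReal_le_ofReal hε'2)) (h₁ ρ ?_)
      exact (min_le_left _ _).trans (min_le_left _ _)
  · refine (lintegral_lintegral_enorm_sub_le (B := fun s x => mollify ρ (Du s) x) ?_).trans ?_
    · exact ((aestronglyMeasurable_mollify_prod ρ hu.aestronglyMeasurable_grad).sub
        hu.aestronglyMeasurable_grad).mono_ac hac
    · rw [← add_halves ε, ENNReal.ofReal_add (by positivity) (by positivity)]
      refine add_le_add ?_ (h₂ ρ ((min_le_left _ _).trans (min_le_right _ _)))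
      calc _ ≤ ∫⁻ s in Ioc 0 T, (∫⁻ x in Metric.ball (0 : R3) R, ENNReal.ofReal ε') := by
            refine lintegral_mono_ae ?_
            filter_upwards [hu.weakGradient, ae_restrict_mem measurableSet_Ioc] with s hs hsT
            refine setLIntegral_mono' measurableSet_ball fun x hx => ?_
            rw [← hs.fderiv_mollify, ← ofReal_norm]
            exact ENNReal.ofReal_le_ofReal (hU1 s (Ioc_subset_Icc_self hsT) x hx)
        _ = ENNReal.ofReal (ε' * V * T) := by
            rw [lintegral_const, Measure.restrict_apply_univ, lintegral_const,
              Measure.restrict_apply_univ, Real.volume_Ioc, sub_zero,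
              ENNReal.ofReal_mul (by positivity), ENNReal.ofReal_mul (by positivity), hV,
              ENNReal.ofReal_toReal measure_ball_lt_top.ne]
        _ ≤ _ := by
            refine ENNReal.ofReal_le_ofReal ?_
            have h3 : ε' ≤ ε / (2 * (1 + T * V)) := min_le_right _ _
            rw [le_div_iff₀ (by positivity)] at h3
            nlinarith

/-- Convergence is asked at every time, not almost every time, because the weak formulation
evaluates the test function at the times `0` and `t`. It follows from Lebesgue differentiation for
`u s` and the closeness of `U k` to the mollification. -/
theorem exists_seq_contDiff_approx {T : ℝ} {u ut : ℝ → R3 → R3} {Du : ℝ → R3 → R3 →L[ℝ] R3}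
    (hT : 0 ≤ T) (hu : IsL1Lipschitz T u Du) (hut : IsWeakTimeDeriv T u ut) :
    ∃ U : ℕ → ℝ × R3 → R3, (∀ k, ContDiff ℝ ∞ (U k)) ∧
      (∀ s ∈ Icc 0 T, ∀ᵐ x, Tendsto (fun k => U k (s, x)) atTop (𝓝 (u s x))) ∧
      ∀ R, Tendsto (fun k => ∫⁻ y, ‖fderiv ℝ (U k) (y.1, y.2.1) (1, y.2.2) -
        (ut y.1 y.2.1 + Du y.1 y.2.1 y.2.2)‖ₑ
        ∂((volume.restrict (Ioc 0 T)).prod (volume.restrict (Metric.ball (0 : R3 × R3) R))))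
        atTop (𝓝 0) := by
  -- The ball grows with `k` while the scale shrinks, so every fixed ball is eventually covered.
  choose U ρ hU hρ hρ2 hU0 hU1 hU2 using fun k : ℕ =>
    exists_contDiff_approx hT hu hut k (ε := 1 / ((k : ℝ) + 1)) (by positivity)
  have hlim : Tendsto (fun k : ℕ => 1 / ((k : ℝ) + 1)) atTop (𝓝 0) :=
    tendsto_one_div_add_atTop_nhds_zero_nat
  refine ⟨U, hU, ?_, ?_⟩
  · intro s hs
    have h1 := ContDiffBump.ae_convolution_tendsto_right_of_locallyIntegrable (φ := ρ) (K := 2)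
      (l := atTop) (squeeze_zero (fun k => (ρ k).rOut_pos.le) hρ hlim)
      (Eventually.of_forall hρ2) (hut.locallyIntegrable s hs)
    filter_upwards [h1] with x hx
    simp_rw [← mollify_eq_convolution] at hx
    have h2 : Tendsto (fun k => U k (s, x) - mollify (ρ k) (u s) x) atTop (𝓝 0) := by
      refine squeeze_zero_norm' ?_ hlim
      filter_upwards [eventually_gt_atTop ⌈‖x‖⌉₊] with k hk
      refine hU0 k s hs x ?_
      rw [mem_ball_zero_iff]
      exact (Nat.le_ceil _).trans_lt (by exact_mod_cast hk)
    simpa using h2.add hx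
  · intro R
    have hR : ∀ᶠ k : ℕ in atTop, R ≤ k := by
      filter_upwards [eventually_ge_atTop ⌈R⌉₊] with k hk
      exact (Nat.le_ceil _).trans (by exact_mod_cast hk)
    set V := volume (Metric.ball (0 : R3) R) with hV
    have hVt : V ≠ ⊤ := measure_ball_lt_top.ne
    have hlim2 : Tendsto (fun k : ℕ => (ENNReal.ofReal (1 / ((k : ℝ) + 1)) +
        ENNReal.ofReal (1 / ((k : ℝ) + 1)) * ENNReal.ofReal R) * V) atTop (𝓝 0) := by
      have h1 : Tendsto (fun k : ℕ => ENNReal.ofReal (1 / ((k : ℝ) + 1))) atTop (𝓝 0) := by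
        simpa using ENNReal.tendsto_ofReal hlim
      have h2 := ENNReal.Tendsto.mul_const (b := V)
        (h1.add (ENNReal.Tendsto.mul_const (b := ENNReal.ofReal R) h1
        (Or.inr ENNReal.ofReal_ne_top))) (Or.inr hVt)
      simpa using h2
    refine tendsto_of_tendsto_of_tendsto_of_le_of_le' tendsto_const_nhds hlim2
      (Eventually.of_forall fun k => zero_le) ?_
    filter_upwards [hR] with k hk
    have hsub : Metric.ball (0 : R3) R ⊆ Metric.ball 0 k := Metric.ball_subset_ball hk
    set μ := volume.restrict (Ioc 0 T) with hμ
    set ν := volume.restrict (Metric.ball (0 : R3) R) with hν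
    have hprod : volume.restrict (Metric.ball (0 : R3 × R3) R) = ν.prod ν := by
      rw [hν, Measure.prod_restrict, ← Measure.volume_eq_prod, ball_prod_same]
      rfl
    have hacν : μ.prod ν ≪ μ.prod volume :=
      Measure.AbsolutelyContinuous.rfl.prod Measure.restrict_le_self.absolutelyContinuous
    have hdc : Continuous (fderiv ℝ (U k)) := (hU k).continuous_fderiv (by simp)
    have hm1 : AEStronglyMeasurable
        (fun y : ℝ × R3 => fderiv ℝ (U k) (y.1, y.2) (1, 0) - ut y.1 y.2) (μ.prod ν) := by
      refine AEStronglyMeasurable.sub ?_ (hut.aestronglyMeasurable_deriv.mono_ac hacν)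
      exact Continuous.aestronglyMeasurable (by fun_prop)
    have hpart : ∀ s x, fderiv ℝ (fun x => U k (s, x)) x =
        (fderiv ℝ (U k) (s, x)).comp (ContinuousLinearMap.inr ℝ ℝ R3) := by
      intro s x
      exact (((hU k).differentiable (by simp) (s, x)).hasFDerivAt.comp x
        (hasFDerivAt_prodMk_right s x)).fderiv
    have hm2 : AEStronglyMeasurable
        (fun y : ℝ × R3 => fderiv ℝ (fun x => U k (y.1, x)) y.2 - Du y.1 y.2) (μ.prod ν) := by
      refine AEStronglyMeasurable.sub ?_ (hu.aestronglyMeasurable_grad.mono_ac hacν)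
      simp_rw [hpart]
      exact Continuous.aestronglyMeasurable (by fun_prop)
    have hm : AEStronglyMeasurable (fun y : ℝ × (R3 × R3) =>
        fderiv ℝ (U k) (y.1, y.2.1) (1, y.2.2) - (ut y.1 y.2.1 + Du y.1 y.2.1 y.2.2))
        (μ.prod (ν.prod ν)) := by
      have hq := quasiMeasurePreserving_fst_fst μ ν ν
      refine AEStronglyMeasurable.sub (Continuous.aestronglyMeasurable (by fun_prop)) ?_
      refine AEStronglyMeasurable.add ?_ ?_
      · exact (hut.aestronglyMeasurable_deriv.mono_ac hacν).comp_quasiMeasurePreserving hq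
      · have h1 := (hu.aestronglyMeasurable_grad.mono_ac hacν).comp_quasiMeasurePreserving hq
        have h2 : AEStronglyMeasurable (fun y : ℝ × (R3 × R3) => y.2.2) (μ.prod (ν.prod ν)) :=
          Continuous.aestronglyMeasurable (by fun_prop)
        exact aestronglyMeasurable_clm_apply h1 h2
    rw [hprod, lintegral_prod _ hm.enorm]
    -- The integrand is affine in `v` and `|v| < R`, so the bound is free of `v` and integration in
    -- `v` contributes the volume `V`.
    calc _ ≤ ∫⁻ s, (∫⁻ x, (‖fderiv ℝ (U k) (s, x) (1, 0) - ut s x‖ₑ +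
          ‖fderiv ℝ (fun x => U k (s, x)) x - Du s x‖ₑ * ENNReal.ofReal R) * V ∂ν) ∂μ := by
          refine lintegral_mono_ae ?_
          filter_upwards [hm.prodMk_left] with s hs
          rw [lintegral_prod _ hs.enorm]
          refine lintegral_mono fun x => ?_
          rw [hV, ← Measure.restrict_apply_univ (μ := volume) (Metric.ball (0 : R3) R),
            ← lintegral_const]
          refine setLIntegral_mono' measurableSet_ball fun v hv => ?_
          have h1 : fderiv ℝ (U k) (s, x) (1, v) - (ut s x + Du s x v) =
              (fderiv ℝ (U k) (s, x) (1, 0) - ut s x) +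
                (fderiv ℝ (fun x => U k (s, x)) x - Du s x) v := by
            have : ((1, v) : ℝ × R3) = (1, 0) + (0, v) := by simp
            rw [hpart, this, map_add]
            simp only [sub_apply, ContinuousLinearMap.comp_apply, ContinuousLinearMap.inr_apply]
            abel
          simp only
          rw [h1]
          refine (enorm_add_le _ _).trans (add_le_add le_rfl ?_)
          refine (ContinuousLinearMap.le_opENorm _ _).trans ?_
          gcongr
          rw [← ofReal_norm]
          exact ENNReal.ofReal_le_ofReal (mem_ball_zero_iff.1 hv).le
      _ = ((∫⁻ s, (∫⁻ x, ‖fderiv ℝ (U k) (s, x) (1, 0) - ut s x‖ₑ ∂ν) ∂μ) +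
          (∫⁻ s, (∫⁻ x, ‖fderiv ℝ (fun x => U k (s, x)) x - Du s x‖ₑ ∂ν) ∂μ) *
            ENNReal.ofReal R) * V := by
          simp_rw [lintegral_mul_const' _ _ hVt]
          congr 1
          rw [← lintegral_mul_const' _ _ ENNReal.ofReal_ne_top,
            ← lintegral_add_left' hm1.enorm.lintegral_prod_right']
          refine lintegral_congr_ae ?_
          filter_upwards [hm1.prodMk_left] with s hs
          rw [lintegral_add_left' hs.enorm, lintegral_mul_const' _ _ ENNReal.ofReal_ne_top]
      _ ≤ _ := by
          gcongr
          · refine le_trans (lintegral_mono fun s => ?_) (hU1 k)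
            exact lintegral_mono_set hsub
          · refine le_trans (lintegral_mono fun s => ?_) (hU2 k)
            exact lintegral_mono_set hsub

/-! ### Limits under the integral sign and null sets in products. -/

theorem integrable_inner_of_bounded {α E : Type*} [MeasurableSpace α] {ν : Measure α}
    [NormedAddCommGroup E] [InnerProductSpace ℝ E] {B c : α → E} {M : ℝ}
    (hB : AEStronglyMeasurable B ν) (hBM : ∀ᵐ y ∂ν, ‖B y‖ ≤ M) (hc : Integrable c ν) :
    Integrable (fun y => inner ℝ (B y) (c y)) ν := by
  refine (hc.norm.const_mul M).mono' (hB.inner hc.1) ?_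
  filter_upwards [hBM] with y hy
  exact (norm_inner_le_norm _ _).trans (by gcongr)

/-- Write `⟨B k, c k⟩ = ⟨B k, c'⟩ + ⟨B k, c k - c'⟩`: dominated convergence handles the first term,
the uniform bound on `B k` the second. -/
theorem tendsto_integral_inner_of_tendsto_lintegral {α E : Type*} [MeasurableSpace α]
    {ν : Measure α} [NormedAddCommGroup E] [InnerProductSpace ℝ E]
    {B : ℕ → α → E} {B' : α → E} {c : ℕ → α → E} {c' : α → E} {M : ℝ}
    (hBm : ∀ k, AEStronglyMeasurable (B k) ν) (hBM : ∀ k, ∀ᵐ y ∂ν, ‖B k y‖ ≤ M)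
    (hB : ∀ᵐ y ∂ν, Tendsto (fun k => B k y) atTop (𝓝 (B' y)))
    (hc : ∀ k, Integrable (c k) ν) (hc' : Integrable c' ν)
    (hlim : Tendsto (fun k => ∫⁻ y, ‖c k y - c' y‖ₑ ∂ν) atTop (𝓝 0)) :
    Tendsto (fun k => ∫ y, inner ℝ (B k y) (c k y) ∂ν) atTop
      (𝓝 (∫ y, inner ℝ (B' y) (c' y) ∂ν)) := by
  have h1 : Tendsto (fun k => ∫ y, inner ℝ (B k y) (c' y) ∂ν) atTop
      (𝓝 (∫ y, inner ℝ (B' y) (c' y) ∂ν)) := by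
    refine tendsto_integral_of_dominated_convergence (fun y => M * ‖c' y‖)
      (fun k => (hBm k).inner hc'.1) (hc'.norm.const_mul M) (fun k => ?_) ?_
    · filter_upwards [hBM k] with y hy
      exact (norm_inner_le_norm _ _).trans (by gcongr)
    · filter_upwards [hB] with y hy
      exact hy.inner tendsto_const_nhds
  have h2 : Tendsto (fun k => ∫ y, inner ℝ (B k y) (c k y - c' y) ∂ν) atTop (𝓝 0) := by
    have h3 : Tendsto (fun k => M * (∫⁻ y, ‖c k y - c' y‖ₑ ∂ν).toReal) atTop (𝓝 0) := by
      have := ((ENNReal.tendsto_toReal ENNReal.zero_ne_top).comp hlim).const_mul M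
      simpa using this
    refine squeeze_zero_norm (fun k => ?_) h3
    have hck : Integrable (fun y => c k y - c' y) ν := (hc k).sub hc'
    rw [← integral_norm_eq_lintegral_enorm hck.1, ← integral_const_mul]
    refine norm_integral_le_of_norm_le (hck.norm.const_mul M) ?_
    filter_upwards [hBM k] with y hy
    exact (norm_inner_le_norm _ _).trans (by gcongr)
  have h4 := h1.add h2
  rw [add_zero] at h4
  refine h4.congr fun k => ?_
  rw [← integral_add (integrable_inner_of_bounded (hBm k) (hBM k) hc')
    (integrable_inner_of_bounded (c := fun y => c k y - c' y) (hBm k) (hBM k) ((hc k).sub hc'))]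
  refine integral_congr_ae (Eventually.of_forall fun y => ?_)
  simp only [← inner_add_right]
  congr 1
  abel

/-- Iterated null sets give a product null set only for measurable sets, hence the detour through a
measurable representative. -/
theorem ae_prod_mem_of_ae_ae_mem {α β E : Type*} [MeasurableSpace α] [MeasurableSpace β]
    [TopologicalSpace E] [TopologicalSpace.PseudoMetrizableSpace E] [MeasurableSpace E]
    [BorelSpace E] {μ : Measure α} {ν : Measure β} [SFinite μ] [SFinite ν]
    {F : α → β → E} {S : Set E}
    (hF : AEStronglyMeasurable (fun y : α × β => F y.1 y.2) (μ.prod ν)) (hS : MeasurableSet S)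
    (h : ∀ᵐ x ∂μ, ∀ᵐ y ∂ν, F x y ∈ S) : ∀ᵐ y ∂(μ.prod ν), F y.1 y.2 ∈ S := by
  have h1 : ∀ᵐ y ∂(μ.prod ν), hF.mk _ y ∈ S := by
    rw [Measure.ae_prod_iff_ae_ae (hF.stronglyMeasurable_mk.measurable hS)]
    filter_upwards [h, Measure.ae_ae_of_ae_prod hF.ae_eq_mk] with x hx hx'
    filter_upwards [hx, hx'] with y hy hy'
    rwa [← hy']
  filter_upwards [h1, hF.ae_eq_mk] with y hy hy'
  rwa [hy']

theorem ae_prod_tendsto_of_ae_ae_tendsto {α β E : Type*} [MeasurableSpace α] [MeasurableSpace β]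
    [TopologicalSpace E] [TopologicalSpace.PseudoMetrizableSpace E] [MeasurableSpace E]
    [BorelSpace E] [SecondCountableTopology E] {μ : Measure α} {ν : Measure β}
    [SFinite μ] [SFinite ν] {F : α → β → E} {U : ℕ → α × β → E}
    (hF : AEStronglyMeasurable (fun y : α × β => F y.1 y.2) (μ.prod ν))
    (hU : ∀ k, Measurable (U k))
    (h : ∀ᵐ x ∂μ, ∀ᵐ y ∂ν, Tendsto (fun k => U k (x, y)) atTop (𝓝 (F x y))) :
    ∀ᵐ y ∂(μ.prod ν), Tendsto (fun k => U k y) atTop (𝓝 (F y.1 y.2)) := by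
  have h1 : ∀ᵐ y ∂(μ.prod ν), Tendsto (fun k => U k y) atTop (𝓝 (hF.mk _ y)) := by
    rw [Measure.ae_prod_iff_ae_ae
      (measurableSet_tendsto_fun hU hF.stronglyMeasurable_mk.measurable)]
    filter_upwards [h, Measure.ae_ae_of_ae_prod hF.ae_eq_mk] with x hx hx'
    filter_upwards [hx, hx'] with y hy hy'
    rwa [← hy']
  filter_upwards [h1, hF.ae_eq_mk] with y hy hy'
  rwa [hy']

theorem integrable_comp_fst_fst {α β γ E : Type*} [MeasurableSpace α] [MeasurableSpace β]
    [MeasurableSpace γ] [NormedAddCommGroup E] {μ : Measure α} {ν : Measure β} {ν' : Measure γ}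
    [SFinite μ] [SFinite ν] [IsFiniteMeasure ν'] {F : α × β → E} (hF : Integrable F (μ.prod ν)) :
    Integrable (fun y : α × (β × γ) => F (y.1, y.2.1)) (μ.prod (ν.prod ν')) := by
  have h1 : Integrable (fun y : (α × β) × γ => F y.1) ((μ.prod ν).prod ν') := hF.comp_fst ν'
  have h2 := measurePreserving_prodAssoc μ ν ν'
  exact (h2.integrable_comp_emb MeasurableEquiv.prodAssoc.measurableEmbedding).1 h1

/-! ### Testing the Vlasov equation with a function of the relative velocity. -/

theorem fderiv_testFunction {U : ℝ × R3 → R3} (hU : ContDiff ℝ ∞ U) {γ : ℝ → ℝ}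
    (hγ : ContDiff ℝ ∞ γ) {χ : R3 × R3 → ℝ} (hχ : ContDiff ℝ ∞ χ) {c : ℝ → ℝ} {s : ℝ}
    (hc : c =ᶠ[𝓝 s] fun _ => 1) (z : R3 × R3) (b : R3) :
    fderiv ℝ (fun y : ℝ × (R3 × R3) => c y.1 * (χ y.2 * γ (‖y.2.2 - U (y.1, y.2.1)‖ ^ 2)))
      (s, z) (1, (z.2, b)) =
    γ (‖z.2 - U (s, z.1)‖ ^ 2) * fderiv ℝ χ z (z.2, b) +
      χ z * inner ℝ ((2 * deriv γ (‖z.2 - U (s, z.1)‖ ^ 2)) • (z.2 - U (s, z.1)))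
        (b - fderiv ℝ U (s, z.1) (1, z.2)) := by
  -- Along `(1, v, b)` the vector `v - U` changes at rate `b - DU(1,v)`, which is the source of the
  -- inner product; the time cutoff `c` is locally `1` and drops out.
  have hw : HasFDerivAt (fun y : ℝ × (R3 × R3) => y.2.2 - U (y.1, y.2.1))
      (((ContinuousLinearMap.snd ℝ R3 R3).comp (ContinuousLinearMap.snd ℝ ℝ (R3 × R3))) -
        (fderiv ℝ U (s, z.1)).comp ((ContinuousLinearMap.fst ℝ ℝ (R3 × R3)).prod
          ((ContinuousLinearMap.fst ℝ R3 R3).comp (ContinuousLinearMap.snd ℝ ℝ (R3 × R3)))))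
      (s, z) := by
    refine HasFDerivAt.sub ?_ ?_
    · exact ContinuousLinearMap.hasFDerivAt
        ((ContinuousLinearMap.snd ℝ R3 R3).comp (ContinuousLinearMap.snd ℝ ℝ (R3 × R3)))
    · exact (hU.differentiable (by simp) (s, z.1)).hasFDerivAt.comp (s, z)
        (ContinuousLinearMap.hasFDerivAt ((ContinuousLinearMap.fst ℝ ℝ (R3 × R3)).prod
          ((ContinuousLinearMap.fst ℝ R3 R3).comp (ContinuousLinearMap.snd ℝ ℝ (R3 × R3)))))
  have hg := (hγ.differentiable (by simp) (‖z.2 - U (s, z.1)‖ ^ 2)).hasDerivAt.comp_hasFDerivAt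
    (s, z) hw.norm_sq
  have hx : HasFDerivAt (fun y : ℝ × (R3 × R3) => χ y.2)
      ((fderiv ℝ χ z).comp (ContinuousLinearMap.snd ℝ ℝ (R3 × R3))) (s, z) :=
    (hχ.differentiable (by simp) z).hasFDerivAt.comp (s, z) hasFDerivAt_snd
  have hm := hx.mul hg
  have heq : (fun y : ℝ × (R3 × R3) => c y.1 * (χ y.2 * γ (‖y.2.2 - U (y.1, y.2.1)‖ ^ 2)))
      =ᶠ[𝓝 (s, z)] fun y => χ y.2 * γ (‖y.2.2 - U (y.1, y.2.1)‖ ^ 2) := by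
    filter_upwards [(continuous_fst.tendsto (s, z)).eventually hc] with y hy
    rw [hy, one_mul]
  have hm' : fderiv ℝ (fun y : ℝ × (R3 × R3) => χ y.2 * γ (‖y.2.2 - U (y.1, y.2.1)‖ ^ 2)) (s, z) =
    _ := hm.fderiv
  rw [heq.fderiv_eq, hm']
  simp [inner_smul_left, inner_sub_left, inner_sub_right]
  ring

theorem restrict_Ioc_prod_le {β : Type*} [MeasurableSpace β] (ν : Measure β) [SFinite ν] {t T : ℝ}
    (h : t ≤ T) :
    (volume.restrict (Ioc 0 t)).prod ν ≤ (volume.restrict (Ioc 0 T)).prod ν := by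
  have := Measure.prod_restrict (μ := (volume : Measure ℝ)) (ν := ν) (Ioc 0 t) univ
  rw [Measure.restrict_univ] at this
  have h2 := Measure.prod_restrict (μ := (volume : Measure ℝ)) (ν := ν) (Ioc 0 T) univ
  rw [Measure.restrict_univ] at h2
  rw [this, h2]
  exact Measure.restrict_mono (prod_mono_left (Ioc_subset_Ioc_right h)) le_rfl

theorem prod_restrict_right_eq {α β : Type*} [MeasurableSpace α] [MeasurableSpace β]
    (μ : Measure α) (ν : Measure β) [SFinite μ] [SFinite ν] (B : Set β) :
    μ.prod (ν.restrict B) = (μ.prod ν).restrict (univ ×ˢ B) := by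
  rw [← Measure.prod_restrict, Measure.restrict_univ]

theorem aestronglyMeasurable_comp_position {E : Type*} [TopologicalSpace E] {T : ℝ}
    {F : ℝ → R3 → E} (hF : AEStronglyMeasurable (fun y : ℝ × R3 => F y.1 y.2)
      ((volume.restrict (Ioc 0 T)).prod volume)) :
    AEStronglyMeasurable (fun y : ℝ × (R3 × R3) => F y.1 y.2.1)
      ((volume.restrict (Ioc 0 T)).prod volume) :=
  hF.comp_quasiMeasurePreserving
    (quasiMeasurePreserving_fst_fst (volume.restrict (Ioc 0 T)) volume volume)

section VlasovSolution

variable {T : ℝ} {u ut : ℝ → R3 → R3} {Du : ℝ → R3 → R3 →L[ℝ] R3} {f : ℝ → R3 × R3 → ℝ}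

theorem IsVlasovSolution.exists_bound (hf : IsVlasovSolution T u f) :
    ∃ F₀ : ℝ, 0 ≤ F₀ ∧
      ∀ᵐ y ∂((volume.restrict (Ioc 0 T)).prod volume), ‖f y.1 y.2‖ ≤ F₀ := by
  obtain ⟨C, hC, hb⟩ := hf.bounded
  have h1 : ∀ t ∈ Icc 0 T, ∀ᵐ z, ‖f t z‖ ≤ C.toReal := by
    intro t ht
    have h2 := (hb t ht).2
    rw [eLpNorm_exponent_top] at h2
    filter_upwards [ae_le_eLpNormEssSup (f := f t) (μ := volume)] with z hz
    rw [← toReal_enorm]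
    exact ENNReal.toReal_mono hC.ne (hz.trans h2)
  refine ⟨C.toReal, ENNReal.toReal_nonneg, ?_⟩
  have h3 := ae_prod_mem_of_ae_ae_mem hf.aestronglyMeasurable
    (S := {r : ℝ | ‖r‖ ≤ C.toReal}) (measurableSet_le (by fun_prop) measurable_const) (by
      filter_upwards [ae_restrict_mem measurableSet_Ioc] with s hs
      exact h1 s (Ioc_subset_Icc_self hs))
  exact h3

theorem IsVlasovSolution.integrable_slice (hf : IsVlasovSolution T u f) {t : ℝ}
    (ht : t ∈ Icc 0 T) : Integrable (f t) := by
  obtain ⟨C, hC, hb⟩ := hf.bounded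
  rw [← memLp_one_iff_integrable]
  exact ⟨hf.aestronglyMeasurable_slice t ht, (hb t ht).1.trans_lt hC⟩

theorem aestronglyMeasurable_slice_velocity (hut : IsWeakTimeDeriv T u ut) {t : ℝ}
    (ht : t ∈ Icc 0 T) : AEStronglyMeasurable (fun z : R3 × R3 => z.2 - u t z.1) volume := by
  refine AEStronglyMeasurable.sub (Continuous.aestronglyMeasurable (by fun_prop)) ?_
  exact (hut.locallyIntegrable t ht).aestronglyMeasurable.comp_fst

/-- The integrand obtained by testing the Vlasov equation with `χ(x,v) γ(|v - u|²)`. -/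
def cutoffIntegrand (γ : ℝ → ℝ) (χ : R3 × R3 → ℝ) (u ut : ℝ → R3 → R3)
    (Du : ℝ → R3 → R3 →L[ℝ] R3) (f : ℝ → R3 × R3 → ℝ) (y : ℝ × (R3 × R3)) : ℝ :=
  f y.1 y.2 * (γ (‖y.2.2 - u y.1 y.2.1‖ ^ 2) *
      fderiv ℝ χ y.2 (y.2.2, u y.1 y.2.1 - y.2.2) +
    χ y.2 * inner ℝ ((2 * deriv γ (‖y.2.2 - u y.1 y.2.1‖ ^ 2)) • (y.2.2 - u y.1 y.2.1))
      (u y.1 y.2.1 - y.2.2 - (ut y.1 y.2.1 + Du y.1 y.2.1 y.2.2)))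

theorem aestronglyMeasurable_cutoffIntegrand (hu : IsL1Lipschitz T u Du)
    (hut : IsWeakTimeDeriv T u ut) (hf : IsVlasovSolution T u f) {γ : ℝ → ℝ}
    (hγ : ContDiff ℝ ∞ γ) {χ : R3 × R3 → ℝ} (hχ : ContDiff ℝ ∞ χ) :
    AEStronglyMeasurable (cutoffIntegrand γ χ u ut Du f)
      ((volume.restrict (Ioc 0 T)).prod volume) := by
  have hum := aestronglyMeasurable_comp_position hu.aestronglyMeasurable
  have hutm := aestronglyMeasurable_comp_position hut.aestronglyMeasurable_deriv
  have hDum := aestronglyMeasurable_comp_position hu.aestronglyMeasurable_grad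
  have hv : AEStronglyMeasurable (fun y : ℝ × (R3 × R3) => y.2.2)
      ((volume.restrict (Ioc 0 T)).prod volume) := Continuous.aestronglyMeasurable (by fun_prop)
  have hDc : Continuous (fderiv ℝ χ) := hχ.continuous_fderiv (by simp)
  have hdγ : Continuous (deriv γ) := hγ.continuous_deriv (by simp)
  have hw := hv.sub hum
  have hw2 := hw.norm.pow 2
  refine hf.aestronglyMeasurable.mul (AEStronglyMeasurable.add
    (AEStronglyMeasurable.mul ?_ ?_) (AEStronglyMeasurable.mul ?_ (AEStronglyMeasurable.inner ?_ ?_)))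
  · exact hγ.continuous.comp_aestronglyMeasurable hw2
  · refine aestronglyMeasurable_clm_apply ?_ (hv.prodMk (hum.sub hv))
    exact Continuous.aestronglyMeasurable (by fun_prop)
  · exact (hχ.continuous.comp continuous_snd).aestronglyMeasurable
  · exact ((hdγ.comp_aestronglyMeasurable hw2).const_mul 2).smul hw
  · exact (hum.sub hv).sub (hutm.add (aestronglyMeasurable_clm_apply hDum hv))

/-- For `|w| ≤ 1` the bound on `γ'` suffices; for `|w| ≥ 1` one uses `|w| ≤ |w|²`. -/
theorem norm_deriv_smul_le {γ : ℝ → ℝ} {M : ℝ} (hM1 : ∀ r, |deriv γ r| ≤ M)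
    (hM2 : ∀ r, 0 ≤ r → |deriv γ r| * r ≤ M) (w : R3) :
    ‖(2 * deriv γ (‖w‖ ^ 2)) • w‖ ≤ 2 * M := by
  rw [norm_smul, norm_mul, Real.norm_eq_abs, Real.norm_eq_abs, abs_two, mul_assoc]
  refine mul_le_mul_of_nonneg_left ?_ (by norm_num)
  rcases le_total ‖w‖ 1 with h | h
  · exact (mul_le_of_le_one_right (abs_nonneg _) h).trans (hM1 _)
  · refine le_trans ?_ (hM2 (‖w‖ ^ 2) (by positivity))
    gcongr
    nlinarith

theorem integrable_relative_acceleration (hu : IsL1Lipschitz T u Du)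
    (hut : IsWeakTimeDeriv T u ut) (R : ℝ) :
    Integrable (fun y : ℝ × (R3 × R3) => ut y.1 y.2.1 + Du y.1 y.2.1 y.2.2)
      ((volume.restrict (Ioc 0 T)).prod (volume.restrict (Metric.ball (0 : R3 × R3) R))) := by
  have hprod : volume.restrict (Metric.ball (0 : R3 × R3) R) =
      (volume.restrict (Metric.ball (0 : R3) R)).prod (volume.restrict (Metric.ball (0 : R3) R)) := by
    rw [Measure.prod_restrict, ← Measure.volume_eq_prod, ball_prod_same]
    rfl
  have : IsFiniteMeasure (volume.restrict (Metric.ball (0 : R3) R)) :=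
    isFiniteMeasure_restrict.2 measure_ball_lt_top.ne
  have h1 := integrable_comp_fst_fst (ν' := volume.restrict (Metric.ball (0 : R3) R))
    (hut.integrable_deriv_prod_ball R)
  have h2 := integrable_comp_fst_fst (ν' := volume.restrict (Metric.ball (0 : R3) R))
    (hu.integrable_grad_prod_ball R)
  rw [← hprod] at h1 h2
  refine h1.add ((h2.norm.mul_const R).mono' ?_ ?_)
  · exact aestronglyMeasurable_clm_apply h2.1 (Continuous.aestronglyMeasurable (by fun_prop))
  · have h3 : ∀ᵐ y ∂((volume.restrict (Ioc 0 T)).prod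
        (volume.restrict (Metric.ball (0 : R3 × R3) R))), y.2 ∈ Metric.ball (0 : R3 × R3) R :=
      Measure.quasiMeasurePreserving_snd.ae (ae_restrict_mem measurableSet_ball)
    filter_upwards [h3] with y hy
    refine (ContinuousLinearMap.le_opNorm _ _).trans ?_
    gcongr
    exact (norm_snd_le _).trans (mem_ball_zero_iff.1 hy).le

theorem integrable_velocity_prod_ball (hu : IsL1Lipschitz T u Du) (R : ℝ) :
    Integrable (fun y : ℝ × (R3 × R3) => u y.1 y.2.1)
      ((volume.restrict (Ioc 0 T)).prod (volume.restrict (Metric.ball (0 : R3 × R3) R))) := by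
  have hprod : volume.restrict (Metric.ball (0 : R3 × R3) R) =
      (volume.restrict (Metric.ball (0 : R3) R)).prod (volume.restrict (Metric.ball (0 : R3) R)) := by
    rw [Measure.prod_restrict, ← Measure.volume_eq_prod, ball_prod_same]
    rfl
  have : IsFiniteMeasure (volume.restrict (Metric.ball (0 : R3) R)) :=
    isFiniteMeasure_restrict.2 measure_ball_lt_top.ne
  have h1 := integrable_comp_fst_fst (ν' := volume.restrict (Metric.ball (0 : R3) R))
    (hu.integrable_prod_ball R)
  rwa [← hprod] at h1

theorem Continuous.integrable_prod_ball {E : Type*} [NormedAddCommGroup E]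
    {F : ℝ × (R3 × R3) → E} (hF : Continuous F) (t R : ℝ) :
    Integrable F
      ((volume.restrict (Ioc 0 t)).prod (volume.restrict (Metric.ball (0 : R3 × R3) R))) := by
  rw [Measure.prod_restrict]
  have h : IntegrableOn F (Icc 0 t ×ˢ Metric.closedBall (0 : R3 × R3) R) (volume.prod volume) :=
    hF.continuousOn.integrableOn_compact (isCompact_Icc.prod (isCompact_closedBall _ _))
  exact h.mono_set (prod_mono Ioc_subset_Icc_self Metric.ball_subset_closedBall)

end VlasovSolution

section VlasovSolution

variable {T : ℝ} {u ut : ℝ → R3 → R3} {Du : ℝ → R3 → R3 →L[ℝ] R3} {f : ℝ → R3 × R3 → ℝ}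

theorem tendsto_integral_slice_cutoff (hf : IsVlasovSolution T u f) {γ : ℝ → ℝ} (hγ : ContDiff ℝ ∞ γ) {M : ℝ}
    (hM0 : ∀ r, |γ r| ≤ M) {χ : R3 × R3 → ℝ} (hχ : ContDiff ℝ ∞ χ) (hχc : HasCompactSupport χ)
    {U : ℕ → ℝ × R3 → R3} (hU : ∀ k, ContDiff ℝ ∞ (U k)) {t : ℝ} (ht : t ∈ Icc 0 T)
    (hlim : ∀ᵐ x, Tendsto (fun k => U k (t, x)) atTop (𝓝 (u t x))) :
    Tendsto (fun k => ∫ z, f t z * (χ z * γ (‖z.2 - U k (t, z.1)‖ ^ 2))) atTop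
      (𝓝 (∫ z, f t z * (χ z * γ (‖z.2 - u t z.1‖ ^ 2)))) := by
  obtain ⟨X, hX⟩ := hχc.exists_bound_of_continuous hχ.continuous
  have hfi := hf.integrable_slice ht
  refine tendsto_integral_of_dominated_convergence (fun z => ‖f t z‖ * (X * M)) (fun k => ?_)
    (hfi.norm.mul_const _) (fun k => Eventually.of_forall fun z => ?_) ?_
  · refine hfi.1.mul (Continuous.aestronglyMeasurable ?_)
    have h1 := hγ.continuous
    have h2 := hχ.continuous
    have h3 := (hU k).continuous
    fun_prop
  · rw [norm_mul, norm_mul]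
    have := hX z
    have := hM0 (‖z.2 - U k (t, z.1)‖ ^ 2)
    rw [← Real.norm_eq_abs] at this
    gcongr
    exact (norm_nonneg _).trans (hX z)
  · have h1 : ∀ᵐ z : R3 × R3, Tendsto (fun k => U k (t, z.1)) atTop (𝓝 (u t z.1)) :=
      Measure.quasiMeasurePreserving_fst.ae hlim
    filter_upwards [h1] with z hz
    refine Tendsto.const_mul _ (Tendsto.const_mul _ ?_)
    exact (hγ.continuous.tendsto _).comp ((tendsto_const_nhds.sub hz).norm.pow 2)

set_option maxHeartbeats 800000 in
-- After testing with `χ γ(|v - U k|²)`, each term pairs a bounded, almost everywhere convergent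
-- factor with one that converges in `L¹` on the support of `χ`. The essential bound on `f` puts `f`
-- in the bounded factor, so local `L¹` convergence of the derivatives of `U k` is enough.
theorem cutoff_identity (hu : IsL1Lipschitz T u Du) (hut : IsWeakTimeDeriv T u ut)
    (hf : IsVlasovSolution T u f) {γ : ℝ → ℝ} (hγ : ContDiff ℝ ∞ γ) {M : ℝ}
    (hM0 : ∀ r, |γ r| ≤ M) (hM1 : ∀ r, |deriv γ r| ≤ M)
    (hM2 : ∀ r, 0 ≤ r → |deriv γ r| * r ≤ M) {χ : R3 × R3 → ℝ} (hχ : ContDiff ℝ ∞ χ)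
    (hχc : HasCompactSupport χ) {t : ℝ} (ht : t ∈ Icc 0 T) :
    (∫ z, f t z * (χ z * γ (‖z.2 - u t z.1‖ ^ 2))) -
      (∫ z, f 0 z * (χ z * γ (‖z.2 - u 0 z.1‖ ^ 2))) =
    ∫ y, cutoffIntegrand γ χ u ut Du f y ∂((volume.restrict (Ioc 0 t)).prod volume) := by
  have hT : 0 ≤ T := ht.1.trans ht.2
  obtain ⟨U, hU, hU0, hU1⟩ := exists_seq_contDiff_approx hT hu hut
  obtain ⟨X, hX⟩ := hχc.exists_bound_of_continuous hχ.continuous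
  have hX0 : 0 ≤ X := (norm_nonneg _).trans (hX 0)
  have hDc : Continuous (fderiv ℝ χ) := hχ.continuous_fderiv (by simp)
  obtain ⟨X', hX'⟩ := (hχc.fderiv ℝ).exists_bound_of_continuous hDc
  have hdγ : Continuous (deriv γ) := hγ.continuous_deriv (by simp)
  obtain ⟨F₀, hF₀, hfb⟩ := hf.exists_bound
  obtain ⟨R, hR0, hR⟩ := hχc.isCompact.isBounded.subset_ball_lt 0 0
  have hχ0 : ∀ z ∉ Metric.ball (0 : R3 × R3) R, χ z = 0 := fun z hz =>
    image_eq_zero_of_notMem_tsupport fun h => hz (hR h)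
  have hDχ0 : ∀ z ∉ Metric.ball (0 : R3 × R3) R, fderiv ℝ χ z = 0 := fun z hz => by
    have : z ∉ tsupport (fderiv ℝ χ) := fun h => hz (hR (tsupport_fderiv_subset ℝ h))
    exact image_eq_zero_of_notMem_tsupport this
  set μ := volume.restrict (Ioc 0 t) with hμ
  set νR := volume.restrict (Metric.ball (0 : R3 × R3) R) with hνR
  have hle : μ.prod νR ≤ (volume.restrict (Ioc 0 T)).prod νR := restrict_Ioc_prod_le _ ht.2
  have hac : μ.prod νR ≪ (volume.restrict (Ioc 0 T)).prod volume :=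
    hle.absolutelyContinuous.trans
      (Measure.AbsolutelyContinuous.rfl.prod Measure.restrict_le_self.absolutelyContinuous)
  have hfb' : ∀ᵐ y ∂(μ.prod νR), ‖f y.1 y.2‖ ≤ F₀ := hac.ae_le hfb
  have hfm : AEStronglyMeasurable (fun y : ℝ × (R3 × R3) => f y.1 y.2) (μ.prod νR) :=
    hf.aestronglyMeasurable.mono_ac hac
  have huI : Integrable (fun y : ℝ × (R3 × R3) => u y.1 y.2.1) (μ.prod νR) :=
    (integrable_velocity_prod_ball hu R).mono_measure hle
  have haI : Integrable (fun y : ℝ × (R3 × R3) => ut y.1 y.2.1 + Du y.1 y.2.1 y.2.2)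
      (μ.prod νR) := (integrable_relative_acceleration hu hut R).mono_measure hle
  have hvI : Integrable (fun y : ℝ × (R3 × R3) => y.2.2) (μ.prod νR) :=
    Continuous.integrable_prod_ball (by fun_prop) t R
  have hDUI : ∀ k, Integrable (fun y : ℝ × (R3 × R3) => fderiv ℝ (U k) (y.1, y.2.1) (1, y.2.2))
      (μ.prod νR) := fun k => by
    have : Continuous (fderiv ℝ (U k)) := (hU k).continuous_fderiv (by simp)
    exact Continuous.integrable_prod_ball (by fun_prop) t R
  have hUlim : ∀ᵐ y ∂(μ.prod νR), Tendsto (fun k => U k (y.1, y.2.1)) atTop (𝓝 (u y.1 y.2.1)) := by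
    have h1 := ae_prod_tendsto_of_ae_ae_tendsto hu.aestronglyMeasurable
      (fun k => (hU k).continuous.measurable) (by
        filter_upwards [ae_restrict_mem measurableSet_Ioc] with s hs
        exact hU0 s (Ioc_subset_Icc_self hs))
    exact hac.ae_le ((quasiMeasurePreserving_fst_fst (volume.restrict (Ioc 0 T))
      (volume : Measure R3) (volume : Measure R3)).ae h1)
  have hB1m : ∀ k, AEStronglyMeasurable (fun y : ℝ × (R3 × R3) => (f y.1 y.2 * χ y.2) •
      ((2 * deriv γ (‖y.2.2 - U k (y.1, y.2.1)‖ ^ 2)) • (y.2.2 - U k (y.1, y.2.1))))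
      (μ.prod νR) := fun k => by
    refine (hfm.mul (hχ.continuous.comp continuous_snd).aestronglyMeasurable).smul
      (Continuous.aestronglyMeasurable ?_)
    have := (hU k).continuous
    fun_prop
  have hB1b : ∀ w : ℝ × (R3 × R3) → R3, ∀ᵐ y ∂(μ.prod νR), ‖(f y.1 y.2 * χ y.2) •
      ((2 * deriv γ (‖w y‖ ^ 2)) • w y)‖ ≤ F₀ * X * (2 * M) := fun w => by
    filter_upwards [hfb'] with y hy
    rw [norm_smul, norm_mul]
    have h1 := norm_deriv_smul_le hM1 hM2 (w y)
    have h2 := hX y.2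
    gcongr
  have hB2m : ∀ k, AEStronglyMeasurable (fun y : ℝ × (R3 × R3) =>
      f y.1 y.2 * γ (‖y.2.2 - U k (y.1, y.2.1)‖ ^ 2)) (μ.prod νR) := fun k => by
    refine hfm.mul (Continuous.aestronglyMeasurable ?_)
    have := (hU k).continuous
    have := hγ.continuous
    fun_prop
  have hB2b : ∀ w : ℝ × (R3 × R3) → R3, ∀ᵐ y ∂(μ.prod νR),
      ‖f y.1 y.2 * γ (‖w y‖ ^ 2)‖ ≤ F₀ * M := fun w => by
    filter_upwards [hfb'] with y hy
    rw [norm_mul]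
    have h1 := hM0 (‖w y‖ ^ 2)
    rw [← Real.norm_eq_abs] at h1
    gcongr
  have hcI : Integrable (fun y : ℝ × (R3 × R3) => fderiv ℝ χ y.2 (y.2.2, u y.1 y.2.1 - y.2.2))
      (μ.prod νR) := by
    refine ((hvI.norm.add (huI.sub hvI).norm).const_mul X').mono'
      (aestronglyMeasurable_clm_apply (Continuous.aestronglyMeasurable (by fun_prop))
        (hvI.1.prodMk (huI.sub hvI).1)) (Eventually.of_forall fun y => ?_)
    refine ((fderiv ℝ χ y.2).le_opNorm _).trans ?_
    refine mul_le_mul (hX' _) ?_ (norm_nonneg _) ((norm_nonneg _).trans (hX' 0))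
    rw [Prod.norm_mk]
    exact max_le_add_of_nonneg (norm_nonneg _) (norm_nonneg _)
  have hc1I : ∀ k, Integrable (fun y : ℝ × (R3 × R3) =>
      u y.1 y.2.1 - y.2.2 - fderiv ℝ (U k) (y.1, y.2.1) (1, y.2.2)) (μ.prod νR) :=
    fun k => (huI.sub hvI).sub (hDUI k)
  have hc1I' : Integrable (fun y : ℝ × (R3 × R3) =>
      u y.1 y.2.1 - y.2.2 - (ut y.1 y.2.1 + Du y.1 y.2.1 y.2.2)) (μ.prod νR) :=
    (huI.sub hvI).sub haI
  have hwlim : ∀ᵐ y ∂(μ.prod νR), Tendsto (fun k => y.2.2 - U k (y.1, y.2.1)) atTop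
      (𝓝 (y.2.2 - u y.1 y.2.1)) := by
    filter_upwards [hUlim] with y hy
    exact tendsto_const_nhds.sub hy
  have hB1lim : ∀ᵐ y ∂(μ.prod νR), Tendsto (fun k => (f y.1 y.2 * χ y.2) •
      ((2 * deriv γ (‖y.2.2 - U k (y.1, y.2.1)‖ ^ 2)) • (y.2.2 - U k (y.1, y.2.1)))) atTop
      (𝓝 ((f y.1 y.2 * χ y.2) •
        ((2 * deriv γ (‖y.2.2 - u y.1 y.2.1‖ ^ 2)) • (y.2.2 - u y.1 y.2.1)))) := by
    filter_upwards [hwlim] with y h1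
    exact tendsto_const_nhds.smul ((((hdγ.tendsto _).comp (h1.norm.pow 2)).const_mul 2).smul h1)
  have hB2lim : ∀ᵐ y ∂(μ.prod νR), Tendsto (fun k =>
      f y.1 y.2 * γ (‖y.2.2 - U k (y.1, y.2.1)‖ ^ 2)) atTop
      (𝓝 (f y.1 y.2 * γ (‖y.2.2 - u y.1 y.2.1‖ ^ 2))) := by
    filter_upwards [hwlim] with y h1
    exact ((hγ.continuous.tendsto _).comp (h1.norm.pow 2)).const_mul _
  have hlim1 := tendsto_integral_inner_of_tendsto_lintegral hB1m (fun k => hB1b _) hB1lim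
    hc1I hc1I'
    (by
      refine tendsto_of_tendsto_of_tendsto_of_le_of_le tendsto_const_nhds (hU1 R)
        (fun k => zero_le) (fun k => ?_)
      refine le_trans (le_of_eq (lintegral_congr fun y => ?_)) (lintegral_mono' hle le_rfl)
      rw [← enorm_neg]
      congr 1
      abel)
  -- Here the integrable factor carries the derivative of `χ` and does not depend on `k`.
  have hlim2 := tendsto_integral_inner_of_tendsto_lintegral hB2m (fun k => hB2b _) hB2lim
    (fun k => hcI) hcI (by simp)
  have hi1 := integrable_inner_of_bounded (aestronglyMeasurable_of_tendsto_ae atTop hB1m hB1lim)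
    (hB1b fun y => y.2.2 - u y.1 y.2.1) hc1I'
  have hi2 := integrable_inner_of_bounded (aestronglyMeasurable_of_tendsto_ae atTop hB2m hB2lim)
    (hB2b fun y => y.2.2 - u y.1 y.2.1) hcI
  have hrhs : ∫ y, cutoffIntegrand γ χ u ut Du f y ∂(μ.prod volume) =
      (∫ y, inner ℝ ((f y.1 y.2 * χ y.2) •
        ((2 * deriv γ (‖y.2.2 - u y.1 y.2.1‖ ^ 2)) • (y.2.2 - u y.1 y.2.1)))
        (u y.1 y.2.1 - y.2.2 - (ut y.1 y.2.1 + Du y.1 y.2.1 y.2.2)) ∂(μ.prod νR)) +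
      ∫ y, inner ℝ (f y.1 y.2 * γ (‖y.2.2 - u y.1 y.2.1‖ ^ 2))
        (fderiv ℝ χ y.2 (y.2.2, u y.1 y.2.1 - y.2.2)) ∂(μ.prod νR) := by
    rw [← integral_add hi1 hi2]
    rw [hνR, prod_restrict_right_eq, ← setIntegral_eq_integral_of_forall_compl_eq_zero
      (s := univ ×ˢ Metric.ball (0 : R3 × R3) R)]
    · refine integral_congr_ae (Eventually.of_forall fun y => ?_)
      simp only [cutoffIntegrand, inner_smul_left, RCLike.inner_apply, conj_trivial]
      ring
    · intro y hy
      have hy' : y.2 ∉ Metric.ball (0 : R3 × R3) R := fun h => hy ⟨mem_univ _, h⟩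
      simp [cutoffIntegrand, hχ0 _ hy', hDχ0 _ hy']
  -- A time cutoff equal to `1` near `[0,t]` gives compact support without changing any term of the
  -- weak formulation.
  set c : ContDiffBump (0 : ℝ) := ⟨|t| + 1, |t| + 2, by positivity, by linarith⟩ with hc
  have hc1 : ∀ s ∈ Icc 0 t, c =ᶠ[𝓝 s] fun _ => 1 := by
    intro s hs
    apply c.eventuallyEq_one_of_mem_ball
    simp only [hc, Metric.mem_ball, dist_zero_right, Real.norm_eq_abs]
    rw [abs_of_nonneg hs.1]
    linarith [hs.2, le_abs_self t]
  have hweak : ∀ k, (∫ z, f t z * (χ z * γ (‖z.2 - U k (t, z.1)‖ ^ 2))) -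
      (∫ z, f 0 z * (χ z * γ (‖z.2 - U k (0, z.1)‖ ^ 2))) =
      (∫ y, inner ℝ ((f y.1 y.2 * χ y.2) •
        ((2 * deriv γ (‖y.2.2 - U k (y.1, y.2.1)‖ ^ 2)) • (y.2.2 - U k (y.1, y.2.1))))
        (u y.1 y.2.1 - y.2.2 - fderiv ℝ (U k) (y.1, y.2.1) (1, y.2.2)) ∂(μ.prod νR)) +
      ∫ y, inner ℝ (f y.1 y.2 * γ (‖y.2.2 - U k (y.1, y.2.1)‖ ^ 2))
        (fderiv ℝ χ y.2 (y.2.2, u y.1 y.2.1 - y.2.2)) ∂(μ.prod νR) := by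
    intro k
    have hψ : ContDiff ℝ ∞ fun y : ℝ × (R3 × R3) =>
        c y.1 * (χ y.2 * γ (‖y.2.2 - U k (y.1, y.2.1)‖ ^ 2)) := by
      have h1 : ContDiff ℝ ∞ fun y : ℝ × (R3 × R3) => y.2.2 - U k (y.1, y.2.1) :=
        ContDiff.sub (by fun_prop) ((hU k).comp (by fun_prop))
      exact (c.contDiff.comp contDiff_fst).mul ((hχ.comp contDiff_snd).mul
        (hγ.comp (h1.norm_sq ℝ)))
    have hψc : HasCompactSupport fun y : ℝ × (R3 × R3) =>
        c y.1 * (χ y.2 * γ (‖y.2.2 - U k (y.1, y.2.1)‖ ^ 2)) := by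
      refine HasCompactSupport.intro (c.hasCompactSupport.isCompact.prod hχc.isCompact) ?_
      intro y hy
      by_contra h
      exact hy ⟨subset_tsupport _ (left_ne_zero_of_mul h),
        subset_tsupport _ (left_ne_zero_of_mul (right_ne_zero_of_mul h))⟩
    have h := hf.weak_eq _ hψ hψc t ht
    simp only at h
    rw [(hc1 t ⟨ht.1, le_rfl⟩).eq_of_nhds, (hc1 0 ⟨le_rfl, ht.1⟩).eq_of_nhds] at h
    simp only [one_mul] at h
    have hi1 := integrable_inner_of_bounded (hB1m k) (hB1b fun y => y.2.2 - U k (y.1, y.2.1))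
      (hc1I k)
    have hi2 := integrable_inner_of_bounded (hB2m k) (hB2b fun y => y.2.2 - U k (y.1, y.2.1)) hcI
    rw [h, ← integral_add hi1 hi2, integral_prod _ (hi1.fun_add hi2),
      intervalIntegral.integral_of_le ht.1]
    refine setIntegral_congr_fun measurableSet_Ioc fun s hs => ?_
    simp only
    rw [← setIntegral_eq_integral_of_forall_compl_eq_zero
      (s := Metric.ball (0 : R3 × R3) R)]
    · refine integral_congr_ae (Eventually.of_forall fun z => ?_)
      simp only
      rw [fderiv_testFunction (hU k) hγ hχ (hc1 s (Ioc_subset_Icc_self hs))]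
      simp only [inner_smul_left, RCLike.inner_apply, conj_trivial]
      ring
    · intro z hz
      rw [fderiv_testFunction (hU k) hγ hχ (hc1 s (Ioc_subset_Icc_self hs)), hχ0 z hz, hDχ0 z hz]
      simp
  rw [hrhs]
  refine tendsto_nhds_unique ?_ (hlim1.add hlim2)
  simp_rw [← hweak]
  exact (tendsto_integral_slice_cutoff hf hγ hM0 hχ hχc hU ht (hU0 t ht)).sub
    (tendsto_integral_slice_cutoff hf hγ hM0 hχ hχc hU ⟨le_rfl, hT⟩ (hU0 0 ⟨le_rfl, hT⟩))

end VlasovSolution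

/-! ### Removing the phase-space cutoff. -/

section VlasovSolution

variable {T : ℝ} {u ut : ℝ → R3 → R3} {Du : ℝ → R3 → R3 →L[ℝ] R3} {f : ℝ → R3 × R3 → ℝ}

theorem IsVlasovSolution.integrable_prod (hf : IsVlasovSolution T u f) :
    Integrable (fun y : ℝ × (R3 × R3) => f y.1 y.2) ((volume.restrict (Ioc 0 T)).prod volume) := by
  obtain ⟨C, hC, hb⟩ := hf.bounded
  refine ⟨hf.aestronglyMeasurable, ?_⟩
  rw [hasFiniteIntegral_iff_enorm, lintegral_prod _ hf.aestronglyMeasurable.enorm]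
  calc _ ≤ ∫⁻ _ in Ioc 0 T, C := by
        refine setLIntegral_mono' measurableSet_Ioc fun s hs => ?_
        have := (hb s (Ioc_subset_Icc_self hs)).1
        rwa [eLpNorm_one_eq_lintegral_enorm] at this
    _ < ⊤ := by
        rw [lintegral_const, Measure.restrict_apply_univ]
        exact ENNReal.mul_lt_top hC measure_Ioc_lt_top

/-- At each time `u` is essentially bounded, with a norm integrable in time, and `f` is bounded in
`L¹` uniformly in time. -/
theorem IsVlasovSolution.integrable_norm_mul_norm_velocity (hf : IsVlasovSolution T u f)
    (hu : IsL1Lipschitz T u Du) :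
    Integrable (fun y : ℝ × (R3 × R3) => ‖f y.1 y.2‖ * ‖u y.1 y.2.1‖)
      ((volume.restrict (Ioc 0 T)).prod volume) := by
  obtain ⟨C, hC, hb⟩ := hf.bounded
  have hm : AEStronglyMeasurable (fun y : ℝ × (R3 × R3) => ‖f y.1 y.2‖ * ‖u y.1 y.2.1‖)
      ((volume.restrict (Ioc 0 T)).prod volume) :=
    hf.aestronglyMeasurable.norm.mul
      (aestronglyMeasurable_comp_position hu.aestronglyMeasurable).norm
  refine ⟨hm, ?_⟩
  rw [hasFiniteIntegral_iff_enorm, lintegral_prod _ hm.enorm]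
  calc _ ≤ ∫⁻ s in Ioc 0 T, (eLpNorm (u s) ⊤ volume + eLpNorm (Du s) ⊤ volume) * C := by
        refine setLIntegral_mono' measurableSet_Ioc fun s hs => ?_
        have h1 := (hb s (Ioc_subset_Icc_self hs)).1
        rw [eLpNorm_one_eq_lintegral_enorm] at h1
        have h2 : ∀ᵐ z : R3 × R3, ‖u s z.1‖ₑ ≤ eLpNorm (u s) ⊤ volume := by
          have h3 : ∀ᵐ x, ‖u s x‖ₑ ≤ eLpNorm (u s) ⊤ volume := by
            rw [eLpNorm_exponent_top]
            exact ae_le_eLpNormEssSup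
          exact Measure.quasiMeasurePreserving_fst.ae h3
        calc _ ≤ ∫⁻ z, eLpNorm (u s) ⊤ volume * ‖f s z‖ₑ := by
              refine lintegral_mono_ae ?_
              filter_upwards [h2] with z hz
              rw [enorm_mul, enorm_norm, enorm_norm, mul_comm]
              gcongr
          _ = eLpNorm (u s) ⊤ volume * ∫⁻ z, ‖f s z‖ₑ :=
              lintegral_const_mul'' _
                (hf.aestronglyMeasurable_slice s (Ioc_subset_Icc_self hs)).enorm
          _ ≤ _ := by
              gcongr
              exact le_self_add
    _ < ⊤ := by
        rw [lintegral_mul_const' _ _ hC.ne]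
        exact ENNReal.mul_lt_top hu.norm_lt_top hC

/-- The gradient of `χ(z/R)` has size at most `X/R` and vanishes for `|z| > 2R`, so the linear
growth of `v` is absorbed and the bound is uniform in `R ≥ 1`. -/
theorem norm_fderiv_bump_rescale_apply_le {χ : R3 × R3 → ℝ} {X : ℝ}
    (hX : ∀ z, ‖fderiv ℝ χ z‖ ≤ X) (hχ0 : ∀ z, 2 < ‖z‖ → fderiv ℝ χ z = 0) {R : ℝ} (hR : 1 ≤ R)
    (z : R3 × R3) (a : R3) :
    ‖fderiv ℝ (fun z => χ (R⁻¹ • z)) z (z.2, a - z.2)‖ ≤ X * (2 + ‖a‖) := by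
  have hR0 : 0 < R := by linarith
  have hX0 : 0 ≤ X := (norm_nonneg _).trans (hX 0)
  rw [fderiv_comp_smul, smul_apply, norm_smul, Real.norm_eq_abs, abs_of_pos (inv_pos.2 hR0)]
  rcases lt_or_ge 2 ‖R⁻¹ • z‖ with h | h
  · rw [hχ0 _ h]
    simp only [zero_apply, norm_zero, mul_zero]
    positivity
  · rw [norm_smul, Real.norm_eq_abs, abs_of_pos (inv_pos.2 hR0)] at h
    have h1 : ‖fderiv ℝ χ (R⁻¹ • z) (z.2, a - z.2)‖ ≤ X * (‖z‖ + ‖a‖) := by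
      refine (ContinuousLinearMap.le_opNorm _ _).trans ?_
      refine mul_le_mul (hX _) ?_ (norm_nonneg _) hX0
      rw [Prod.norm_mk]
      have := norm_snd_le z
      refine max_le (by linarith [norm_nonneg a]) ?_
      linarith [norm_sub_le a z.2]
    calc _ ≤ R⁻¹ * (X * (‖z‖ + ‖a‖)) := by gcongr
      _ = X * (R⁻¹ * ‖z‖ + R⁻¹ * ‖a‖) := by ring
      _ ≤ X * (2 + 1 * ‖a‖) := by
          have : R⁻¹ ≤ 1 := inv_le_one_of_one_le₀ hR
          gcongr
      _ = _ := by rw [one_mul]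

/-- The integrand obtained by testing the Vlasov equation with `γ(|v - u|²)`. -/
def renormalizedIntegrand (γ : ℝ → ℝ) (u ut : ℝ → R3 → R3)
    (Du : ℝ → R3 → R3 →L[ℝ] R3) (f : ℝ → R3 × R3 → ℝ) (y : ℝ × (R3 × R3)) : ℝ :=
  -(f y.1 y.2 * (2 * deriv γ (‖y.2.2 - u y.1 y.2.1‖ ^ 2)) *
    (‖y.2.2 - u y.1 y.2.1‖ ^ 2 +
      inner ℝ (ut y.1 y.2.1 + Du y.1 y.2.1 y.2.2) (y.2.2 - u y.1 y.2.1)))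

/-- Isolates the term with the derivative of `χ`, the only one that must disappear as `χ → 1`; it
uses `u - v - a = -(w + a)`. -/
theorem cutoffIntegrand_eq (γ : ℝ → ℝ) (χ : R3 × R3 → ℝ) (y : ℝ × (R3 × R3)) :
    cutoffIntegrand γ χ u ut Du f y = f y.1 y.2 * (γ (‖y.2.2 - u y.1 y.2.1‖ ^ 2) *
      fderiv ℝ χ y.2 (y.2.2, u y.1 y.2.1 - y.2.2)) + χ y.2 * renormalizedIntegrand γ u ut Du f y := by
  have h : u y.1 y.2.1 - y.2.2 - (ut y.1 y.2.1 + Du y.1 y.2.1 y.2.2) =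
      -((y.2.2 - u y.1 y.2.1) + (ut y.1 y.2.1 + Du y.1 y.2.1 y.2.2)) := by abel
  simp only [cutoffIntegrand, renormalizedIntegrand]
  rw [h, inner_smul_left, inner_neg_right, inner_add_right, real_inner_self_eq_norm_sq,
    real_inner_comm (y.2.2 - u y.1 y.2.1)]
  simp only [conj_trivial]
  ring

/-- For fixed `γ` the term in `|w|²` is controlled by `f` alone, so integrability here does not
presuppose that `D_p` is finite. -/
theorem norm_renormalizedIntegrand_le {γ : ℝ → ℝ} {M K p : ℝ}
    (hM2 : ∀ r, 0 ≤ r → |deriv γ r| * r ≤ M)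
    (hK : ∀ r, 0 ≤ r → |deriv γ (r ^ 2)| ≤ K * r ^ (p - 2)) (y : ℝ × (R3 × R3)) :
    ‖renormalizedIntegrand γ u ut Du f y‖ ≤ 2 * M * ‖f y.1 y.2‖ +
      2 * K * ‖accelerationDensity p u ut Du f y.1 y.2‖ := by
  simp only [renormalizedIntegrand, accelerationDensity]
  set w := y.2.2 - u y.1 y.2.1
  set a := ut y.1 y.2.1 + Du y.1 y.2.1 y.2.2
  have h1 := hM2 (‖w‖ ^ 2) (by positivity)
  have h2 := hK ‖w‖ (norm_nonneg _)
  have h3 : 0 ≤ ‖w‖ ^ (p - 2) := Real.rpow_nonneg (norm_nonneg _) _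
  rw [norm_neg, norm_mul, norm_mul, norm_mul, norm_mul, norm_mul]
  simp only [Real.norm_eq_abs, abs_two]
  rw [abs_of_nonneg h3]
  calc |f y.1 y.2| * (2 * |deriv γ (‖w‖ ^ 2)|) * |‖w‖ ^ 2 + inner ℝ a w|
      ≤ |f y.1 y.2| * (2 * |deriv γ (‖w‖ ^ 2)|) * (‖w‖ ^ 2 + |inner ℝ a w|) := by
        gcongr
        refine (abs_add_le _ _).trans ?_
        rw [abs_of_nonneg (by positivity : (0 : ℝ) ≤ ‖w‖ ^ 2)]
    _ = 2 * |f y.1 y.2| * (|deriv γ (‖w‖ ^ 2)| * ‖w‖ ^ 2) +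
        2 * |f y.1 y.2| * |deriv γ (‖w‖ ^ 2)| * |inner ℝ a w| := by ring
    _ ≤ 2 * |f y.1 y.2| * M + 2 * |f y.1 y.2| * (K * ‖w‖ ^ (p - 2)) * |inner ℝ a w| := by
        gcongr
    _ = _ := by ring

theorem renormalized_identity (hu : IsL1Lipschitz T u Du) (hut : IsWeakTimeDeriv T u ut)
    (hf : IsVlasovSolution T u f) {γ : ℝ → ℝ} (hγ : ContDiff ℝ ∞ γ) {M K p : ℝ}
    (hM0 : ∀ r, |γ r| ≤ M) (hM1 : ∀ r, |deriv γ r| ≤ M)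
    (hM2 : ∀ r, 0 ≤ r → |deriv γ r| * r ≤ M)
    (hK : ∀ r, 0 ≤ r → |deriv γ (r ^ 2)| ≤ K * r ^ (p - 2)) {t : ℝ} (ht : t ∈ Icc 0 T)
    (hA : Integrable (fun y : ℝ × (R3 × R3) => accelerationDensity p u ut Du f y.1 y.2)
      ((volume.restrict (Ioc 0 t)).prod volume)) :
    (∫ z, f t z * γ (‖z.2 - u t z.1‖ ^ 2)) - (∫ z, f 0 z * γ (‖z.2 - u 0 z.1‖ ^ 2)) =
    ∫ y, renormalizedIntegrand γ u ut Du f y ∂((volume.restrict (Ioc 0 t)).prod volume) := by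
  set χ : ContDiffBump (0 : R3 × R3) := ⟨1, 2, by norm_num, by norm_num⟩ with hχdef
  have hχ : ContDiff ℝ ∞ χ := χ.contDiff
  have hDc : Continuous (fderiv ℝ χ) := hχ.continuous_fderiv (by simp)
  obtain ⟨X, hX⟩ := (χ.hasCompactSupport.fderiv ℝ).exists_bound_of_continuous hDc
  have hX0 : 0 ≤ X := (norm_nonneg _).trans (hX 0)
  have hM : 0 ≤ M := (abs_nonneg _).trans (hM0 0)
  have hχ0 : ∀ z, 2 < ‖z‖ → fderiv ℝ χ z = 0 := fun z hz => by
    have : z ∉ tsupport (fderiv ℝ χ) := fun h => by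
      have h1 := tsupport_fderiv_subset ℝ h
      rw [χ.tsupport_eq, mem_closedBall_zero_iff] at h1
      exact absurd h1 (not_le.2 hz)
    exact image_eq_zero_of_notMem_tsupport this
  set X' : ℕ → R3 × R3 → ℝ := fun n z => χ (((n : ℝ) + 1)⁻¹ • z) with hX'
  have hX's : ∀ n, ContDiff ℝ ∞ (X' n) := fun n => hχ.comp (by fun_prop)
  have hX'c : ∀ n, HasCompactSupport (X' n) := fun n =>
    χ.hasCompactSupport.comp_smul (by positivity)
  have hX'b : ∀ n z, ‖X' n z‖ ≤ 1 := fun n z => by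
    rw [Real.norm_eq_abs, abs_of_nonneg χ.nonneg]
    exact χ.le_one
  -- Equality near `z`, not only at `z`, so that the derivative of the cutoff is eventually zero as
  -- well.
  have hX'1 : ∀ z, ∀ᶠ n : ℕ in atTop, X' n =ᶠ[𝓝 z] fun _ => 1 := fun z => by
    filter_upwards [eventually_ge_atTop ⌈‖z‖⌉₊] with n hn
    have h1 : (((n : ℝ) + 1)⁻¹ • z) ∈ Metric.ball (0 : R3 × R3) χ.rIn := by
      rw [mem_ball_zero_iff, norm_smul, norm_inv, Real.norm_eq_abs, abs_of_pos (by positivity),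
        inv_mul_lt_iff₀ (by positivity)]
      have : ‖z‖ ≤ n := (Nat.le_ceil _).trans (by exact_mod_cast hn)
      simp only [hχdef]
      linarith
    have h2 : Tendsto (fun z : R3 × R3 => ((n : ℝ) + 1)⁻¹ • z) (𝓝 z) (𝓝 (((n : ℝ) + 1)⁻¹ • z)) :=
      Continuous.tendsto (by fun_prop) z
    exact h2.eventually (χ.eventuallyEq_one_of_mem_ball h1)
  have hT : 0 ≤ T := ht.1.trans ht.2
  have hle : (volume.restrict (Ioc 0 t)).prod (volume : Measure (R3 × R3)) ≤
    (volume.restrict (Ioc 0 T)).prod volume := restrict_Ioc_prod_le _ ht.2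
  have hslice : ∀ s ∈ Icc 0 T, Tendsto (fun n => ∫ z, f s z * (X' n z * γ (‖z.2 - u s z.1‖ ^ 2)))
      atTop (𝓝 (∫ z, f s z * γ (‖z.2 - u s z.1‖ ^ 2))) := fun s hs => by
    have hfi := hf.integrable_slice hs
    refine tendsto_integral_of_dominated_convergence (fun z => ‖f s z‖ * (1 * M)) (fun k => ?_)
      (hfi.norm.mul_const _) (fun k => Eventually.of_forall fun z => ?_)
      (Eventually.of_forall fun z => ?_)
    · exact hfi.1.mul ((hX's k).continuous.aestronglyMeasurable.mul
        (hγ.continuous.comp_aestronglyMeasurable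
          ((aestronglyMeasurable_slice_velocity hut hs).norm.pow 2)))
    · rw [norm_mul, norm_mul]
      have h1 := hX'b k z
      have h2 := hM0 (‖z.2 - u s z.1‖ ^ 2)
      rw [← Real.norm_eq_abs] at h2
      gcongr
    · refine tendsto_const_nhds.congr' ?_
      filter_upwards [hX'1 z] with n hn
      rw [hn.eq_of_nhds, one_mul]
  refine tendsto_nhds_unique ((hslice t ht).sub (hslice 0 ⟨le_rfl, hT⟩)) ?_
  simp_rw [fun n => cutoff_identity hu hut hf hγ hM0 hM1 hM2 (hX's n) (hX'c n) ht]
  refine tendsto_integral_of_dominated_convergence (fun y =>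
    M * X * (2 * ‖f y.1 y.2‖ + ‖f y.1 y.2‖ * ‖u y.1 y.2.1‖) + (2 * M * ‖f y.1 y.2‖ +
      2 * K * ‖accelerationDensity p u ut Du f y.1 y.2‖)) (fun n => ?_) ?_
    (fun n => Eventually.of_forall fun y => ?_) (Eventually.of_forall fun y => ?_)
  · exact (aestronglyMeasurable_cutoffIntegrand hu hut hf hγ (hX's n)).mono_measure hle
  · have h1 := hf.integrable_prod.norm.mono_measure hle
    have h2 := (hf.integrable_norm_mul_norm_velocity hu).mono_measure hle
    exact (((h1.const_mul 2).add h2).const_mul _).add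
      ((h1.const_mul _).add (hA.norm.const_mul _))
  · rw [cutoffIntegrand_eq]
    refine (norm_add_le _ _).trans (add_le_add ?_ ?_)
    · have h1 := norm_fderiv_bump_rescale_apply_le hX hχ0 (R := (n : ℝ) + 1) (by simp) y.2
        (u y.1 y.2.1)
      have h2 := hM0 (‖y.2.2 - u y.1 y.2.1‖ ^ 2)
      rw [← Real.norm_eq_abs] at h2
      rw [norm_mul, norm_mul]
      calc _ ≤ ‖f y.1 y.2‖ * (M * (X * (2 + ‖u y.1 y.2.1‖))) := by gcongr
        _ = _ := by ring
    · rw [norm_mul]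
      refine (mul_le_of_le_one_left (norm_nonneg _) (hX'b n _)).trans ?_
      exact norm_renormalizedIntegrand_le hM2 hK y
  · refine tendsto_const_nhds.congr' ?_
    filter_upwards [hX'1 y.2] with n hn
    rw [cutoffIntegrand_eq, hn.eq_of_nhds, hn.fderiv_eq]
    simp

end VlasovSolution

/-! ### Smooth truncations of the power `r^(p/2)`. -/

/-- A smooth compactly supported truncation of `r ↦ (p/2) r^(p/2-1)` on `(0, ∞)`. -/
def truncatedPowerDeriv (p : ℝ) (n : ℕ) (r : ℝ) : ℝ :=
  p / 2 * r ^ (p / 2 - 1) *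
    (Real.smoothTransition ((n + 1) * r - 1) * Real.smoothTransition (n + 2 - r))

/-- A smooth bounded truncation of `r ↦ r^(p/2)` on `[0, ∞)`. -/
def truncatedPower (p : ℝ) (n : ℕ) (r : ℝ) : ℝ :=
  ∫ τ in (0)..r, truncatedPowerDeriv p n τ

section TruncatedPower

variable {p : ℝ} (n : ℕ)

theorem truncatedPowerDeriv_of_lt {r : ℝ} (hr : r < ((n : ℝ) + 1)⁻¹) :
    truncatedPowerDeriv p n r = 0 := by
  have h : ((n : ℝ) + 1) * r - 1 ≤ 0 := by
    have := mul_le_mul_of_nonneg_left hr.le (by positivity : (0 : ℝ) ≤ (n : ℝ) + 1)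
    rw [mul_inv_cancel₀ (by positivity)] at this
    linarith
  rw [truncatedPowerDeriv, Real.smoothTransition.zero_of_nonpos h]
  simp

theorem truncatedPowerDeriv_of_gt {r : ℝ} (hr : (n : ℝ) + 2 < r) :
    truncatedPowerDeriv p n r = 0 := by
  rw [truncatedPowerDeriv, Real.smoothTransition.zero_of_nonpos (x := (n : ℝ) + 2 - r) (by linarith)]
  simp

/-- The lower cutoff vanishes for `r < 1/(n+1)`, negative `r` included; elsewhere `r ≠ 0` and the
real power is smooth. -/
theorem contDiff_truncatedPowerDeriv : ContDiff ℝ ∞ (truncatedPowerDeriv p n) := by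
  rw [contDiff_iff_contDiffAt]
  intro r
  rcases lt_or_ge r ((n : ℝ) + 1)⁻¹ with hr | hr
  · have h : truncatedPowerDeriv p n =ᶠ[𝓝 r] fun _ => 0 := by
      filter_upwards [Iio_mem_nhds hr] with x hx
      exact truncatedPowerDeriv_of_lt n hx
    exact contDiffAt_const.congr_of_eventuallyEq h
  · have hr0 : r ≠ 0 := (lt_of_lt_of_le (by positivity) hr).ne'
    have h1 : ContDiffAt ℝ ∞ (fun r : ℝ => r ^ (p / 2 - 1)) r :=
      Real.contDiffAt_rpow_const_of_ne hr0
    have h2 : ContDiff ℝ ∞ fun r : ℝ => Real.smoothTransition (((n : ℝ) + 1) * r - 1) :=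
      Real.smoothTransition.contDiff.comp (by fun_prop)
    have h3 : ContDiff ℝ ∞ fun r : ℝ => Real.smoothTransition ((n : ℝ) + 2 - r) :=
      Real.smoothTransition.contDiff.comp (by fun_prop)
    exact (contDiffAt_const.mul h1).mul (h2.mul h3).contDiffAt

theorem hasCompactSupport_truncatedPowerDeriv : HasCompactSupport (truncatedPowerDeriv p n) := by
  refine HasCompactSupport.intro (isCompact_Icc (a := 0) (b := (n : ℝ) + 2)) fun r hr => ?_
  rw [mem_Icc, not_and_or, not_le, not_le] at hr
  rcases hr with hr | hr
  · exact truncatedPowerDeriv_of_lt n (hr.trans (by positivity))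
  · exact truncatedPowerDeriv_of_gt n hr

theorem hasDerivAt_truncatedPower (r : ℝ) :
    HasDerivAt (truncatedPower p n) (truncatedPowerDeriv p n r) r :=
  ((contDiff_truncatedPowerDeriv n).continuous.integral_hasStrictDerivAt 0 r).hasDerivAt

theorem deriv_truncatedPower : deriv (truncatedPower p n) = truncatedPowerDeriv p n :=
  funext fun r => (hasDerivAt_truncatedPower n r).deriv

theorem contDiff_truncatedPower : ContDiff ℝ ∞ (truncatedPower p n) := by
  rw [contDiff_infty_iff_deriv, deriv_truncatedPower]
  exact ⟨fun r => (hasDerivAt_truncatedPower n r).differentiableAt,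
    contDiff_truncatedPowerDeriv n⟩

/-- These bounds depend on `n` and serve only to justify the identity for fixed `n`. The bounds
uniform in `n` are `truncatedPower_sq_le` and `abs_deriv_truncatedPower_sq_le`. -/
theorem exists_bound_truncatedPower : ∃ M, (∀ r, |truncatedPower p n r| ≤ M) ∧
    (∀ r, |deriv (truncatedPower p n) r| ≤ M) ∧
    ∀ r, 0 ≤ r → |deriv (truncatedPower p n) r| * r ≤ M := by
  have hc := (contDiff_truncatedPowerDeriv (p := p) n).continuous
  have hcs := hasCompactSupport_truncatedPowerDeriv (p := p) n
  have hint : Integrable (truncatedPowerDeriv p n) := hc.integrable_of_hasCompactSupport hcs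
  obtain ⟨M₁, h₁⟩ := hcs.exists_bound_of_continuous hc
  obtain ⟨M₂, h₂⟩ := (hcs.mul_right (f' := fun r : ℝ => r)).exists_bound_of_continuous
    (hc.mul continuous_id)
  refine ⟨max (∫ r, ‖truncatedPowerDeriv p n r‖) (max M₁ M₂), fun r => ?_, fun r => ?_,
    fun r hr => ?_⟩
  · refine le_trans ?_ (le_max_left _ _)
    rw [← Real.norm_eq_abs, truncatedPower]
    refine intervalIntegral.norm_integral_le_integral_norm_uIoc.trans ?_
    exact setIntegral_le_integral hint.norm (Eventually.of_forall fun _ => norm_nonneg _)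
  · rw [deriv_truncatedPower, ← Real.norm_eq_abs]
    exact (h₁ r).trans ((le_max_left _ _).trans (le_max_right _ _))
  · rw [deriv_truncatedPower]
    have h := h₂ r
    simp only [Pi.mul_apply, norm_mul, Real.norm_eq_abs] at h
    rw [abs_of_nonneg hr] at h
    exact h.trans ((le_max_right _ _).trans (le_max_right _ _))

theorem truncatedPowerDeriv_nonneg (hp : 2 ≤ p) {r : ℝ} (hr : 0 ≤ r) :
    0 ≤ truncatedPowerDeriv p n r := by
  have := Real.rpow_nonneg hr (p / 2 - 1)
  have h1 := Real.smoothTransition.nonneg (((n : ℝ) + 1) * r - 1)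
  have h2 := Real.smoothTransition.nonneg ((n : ℝ) + 2 - r)
  rw [truncatedPowerDeriv]
  positivity

theorem truncatedPowerDeriv_le (hp : 2 ≤ p) {r : ℝ} (hr : 0 ≤ r) :
    truncatedPowerDeriv p n r ≤ p / 2 * r ^ (p / 2 - 1) := by
  have h0 := Real.rpow_nonneg hr (p / 2 - 1)
  refine mul_le_of_le_one_right (by positivity) ?_
  exact mul_le_one₀ (Real.smoothTransition.le_one _) (Real.smoothTransition.nonneg _)
    (Real.smoothTransition.le_one _)

/-- The sequence is eventually constant for `r > 0`. At `r = 0` the limit is wrong for `p = 2`: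
every truncation is `0` there, whereas `0 ^ 0 = 1`. -/
theorem tendsto_truncatedPowerDeriv {r : ℝ} (hr : 0 < r) :
    Tendsto (fun n => truncatedPowerDeriv p n r) atTop (𝓝 (p / 2 * r ^ (p / 2 - 1))) := by
  refine tendsto_const_nhds.congr' ?_
  -- Both cutoffs equal `1` once their arguments are at least `1`: `n ≥ 2/r` gives `(n+1)r - 1 ≥ 1`,
  -- and `n ≥ r` gives `n + 2 - r ≥ 1`.
  filter_upwards [eventually_ge_atTop ⌈2 / r⌉₊, eventually_ge_atTop ⌈r⌉₊] with n hn hn'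
  have h1 : 2 / r ≤ n := (Nat.le_ceil _).trans (by exact_mod_cast hn)
  have h2 : r ≤ n := (Nat.le_ceil _).trans (by exact_mod_cast hn')
  rw [div_le_iff₀ hr] at h1
  rw [truncatedPowerDeriv, Real.smoothTransition.one_of_one_le (by linarith),
    Real.smoothTransition.one_of_one_le (by linarith)]
  simp

theorem sq_rpow_half_sub_one {r : ℝ} (hr : 0 ≤ r) : (r ^ 2) ^ (p / 2 - 1) = r ^ (p - 2) := by
  rw [← Real.rpow_natCast, ← Real.rpow_mul hr]
  congr 1
  push_cast
  ring

/-- With `r^p` written as a primitive, comparison and convergence of the truncated powers follow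
from those of their derivatives. -/
theorem integral_half_mul_rpow (hp : 2 ≤ p) {r : ℝ} (hr : 0 ≤ r) :
    ∫ τ in (0)..r ^ 2, p / 2 * τ ^ (p / 2 - 1) = r ^ p := by
  rw [intervalIntegral.integral_const_mul, integral_rpow (Or.inl (by linarith)), sub_add_cancel,
    Real.zero_rpow (by linarith), sub_zero, ← Real.rpow_natCast, ← Real.rpow_mul hr]
  rw [show ((2 : ℕ) : ℝ) * (p / 2) = p by push_cast; ring]
  field_simp

theorem intervalIntegrable_half_mul_rpow (hp : 2 ≤ p) (r : ℝ) :
    IntervalIntegrable (fun τ : ℝ => p / 2 * τ ^ (p / 2 - 1)) volume 0 r :=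
  (intervalIntegral.intervalIntegrable_rpow' (by linarith)).const_mul _

theorem truncatedPower_nonneg (hp : 2 ≤ p) {r : ℝ} (hr : 0 ≤ r) : 0 ≤ truncatedPower p n r :=
  intervalIntegral.integral_nonneg hr fun _ h => truncatedPowerDeriv_nonneg n hp h.1

theorem truncatedPower_sq_le (hp : 2 ≤ p) {r : ℝ} (hr : 0 ≤ r) :
    truncatedPower p n (r ^ 2) ≤ r ^ p := by
  rw [← integral_half_mul_rpow hp hr, truncatedPower]
  refine intervalIntegral.integral_mono_on (by positivity)
    ((contDiff_truncatedPowerDeriv n).continuous.intervalIntegrable _ _)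
    (intervalIntegrable_half_mul_rpow hp _) fun x hx => truncatedPowerDeriv_le n hp hx.1

theorem tendsto_truncatedPower_sq (hp : 2 ≤ p) {r : ℝ} (hr : 0 ≤ r) :
    Tendsto (fun n => truncatedPower p n (r ^ 2)) atTop (𝓝 (r ^ p)) := by
  rw [← integral_half_mul_rpow hp hr]
  refine intervalIntegral.tendsto_integral_filter_of_dominated_convergence
    (fun τ => p / 2 * τ ^ (p / 2 - 1)) (Eventually.of_forall fun n => ?_)
    (Eventually.of_forall fun n => ?_) (intervalIntegrable_half_mul_rpow hp _) ?_
  · exact (contDiff_truncatedPowerDeriv n).continuous.aestronglyMeasurable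
  · refine Eventually.of_forall fun τ hτ => ?_
    rw [uIoc_of_le (by positivity)] at hτ
    rw [Real.norm_eq_abs, abs_of_nonneg (truncatedPowerDeriv_nonneg n hp hτ.1.le)]
    exact truncatedPowerDeriv_le n hp hτ.1.le
  · refine Eventually.of_forall fun τ hτ => ?_
    rw [uIoc_of_le (by positivity)] at hτ
    exact tendsto_truncatedPowerDeriv hτ.1

theorem abs_deriv_truncatedPower_sq_le (hp : 2 ≤ p) {r : ℝ} (hr : 0 ≤ r) :
    |deriv (truncatedPower p n) (r ^ 2)| ≤ p / 2 * r ^ (p - 2) := by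
  rw [deriv_truncatedPower, abs_of_nonneg (truncatedPowerDeriv_nonneg n hp (by positivity)),
    ← sq_rpow_half_sub_one hr]
  exact truncatedPowerDeriv_le n hp (by positivity)

end TruncatedPower

/-! ### A priori bound and evolution law for the dissipation. -/

section Dissipation

variable {T : ℝ} {u ut : ℝ → R3 → R3} {Du : ℝ → R3 → R3 →L[ℝ] R3} {f : ℝ → R3 × R3 → ℝ}
  {p : ℝ} {t : ℝ}

theorem IsVlasovSolution.ae_nonneg_prod (hf : IsVlasovSolution T u f) :
    ∀ᵐ y ∂((volume.restrict (Ioc 0 T)).prod volume), 0 ≤ f y.1 y.2 :=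
  ae_prod_mem_of_ae_ae_mem hf.aestronglyMeasurable (S := Ici 0) measurableSet_Ici (by
    filter_upwards [ae_restrict_mem measurableSet_Ioc] with s hs
    exact hf.nonneg s (Ioc_subset_Icc_self hs))

theorem aestronglyMeasurable_dissipationDensity (hut : IsWeakTimeDeriv T u ut)
    (hf : IsVlasovSolution T u f) (hp : 2 ≤ p) {s : ℝ} (hs : s ∈ Icc 0 T) :
    AEStronglyMeasurable (dissipationDensity p u f s) volume := by
  have hc : Continuous fun r : ℝ => r ^ p := Real.continuous_rpow_const (by linarith)
  exact (hf.aestronglyMeasurable_slice s hs).mul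
    (hc.comp_aestronglyMeasurable (aestronglyMeasurable_slice_velocity hut hs).norm)

theorem aestronglyMeasurable_dissipationDensity_prod (hu : IsL1Lipschitz T u Du)
    (hf : IsVlasovSolution T u f) (hp : 2 ≤ p) :
    AEStronglyMeasurable (fun y : ℝ × (R3 × R3) => dissipationDensity p u f y.1 y.2)
      ((volume.restrict (Ioc 0 T)).prod volume) := by
  have hc : Continuous fun r : ℝ => r ^ p := Real.continuous_rpow_const (by linarith)
  have hv : AEStronglyMeasurable (fun y : ℝ × (R3 × R3) => y.2.2)
      ((volume.restrict (Ioc 0 T)).prod volume) := Continuous.aestronglyMeasurable (by fun_prop)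
  exact hf.aestronglyMeasurable.mul (hc.comp_aestronglyMeasurable
    (hv.sub (aestronglyMeasurable_comp_position hu.aestronglyMeasurable)).norm)

theorem aestronglyMeasurable_renormalizedIntegrand (hu : IsL1Lipschitz T u Du)
    (hut : IsWeakTimeDeriv T u ut) (hf : IsVlasovSolution T u f) {γ : ℝ → ℝ}
    (hγ : ContDiff ℝ ∞ γ) :
    AEStronglyMeasurable (renormalizedIntegrand γ u ut Du f)
      ((volume.restrict (Ioc 0 T)).prod volume) := by
  refine (aestronglyMeasurable_cutoffIntegrand hu hut hf hγ
    (contDiff_const (c := (1 : ℝ)))).congr (Eventually.of_forall fun y => ?_)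
  simp [cutoffIntegrand_eq]

theorem abs_accelerationDensity (s : ℝ) (z : R3 × R3) :
    |accelerationDensity p u ut Du f s z| = |f s z| * ‖z.2 - u s z.1‖ ^ (p - 2) *
      |inner ℝ (ut s z.1 + Du s z.1 z.2) (z.2 - u s z.1)| := by
  rw [accelerationDensity, abs_mul, abs_mul,
    abs_of_nonneg (Real.rpow_nonneg (norm_nonneg _) (p - 2))]
  ring

theorem rpow_sub_two_mul_sq (hp : 2 ≤ p) {r : ℝ} (hr : 0 ≤ r) : r ^ (p - 2) * r ^ 2 = r ^ p := by
  rw [← Real.rpow_natCast r 2, ← Real.rpow_add_of_nonneg hr (by linarith) (by norm_num)]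
  congr 1
  push_cast
  ring

/-- As `f ≥ 0` and `γ' ≥ 0`, the contribution `-2fγ'|w|²` is nonpositive and can be dropped. The
remaining bound is uniform in `n` and free of `D_p`. -/
theorem renormalizedIntegrand_truncatedPower_le (hp : 2 ≤ p) (n : ℕ) {y : ℝ × (R3 × R3)}
    (hy : 0 ≤ f y.1 y.2) :
    renormalizedIntegrand (truncatedPower p n) u ut Du f y ≤
      p * |accelerationDensity p u ut Du f y.1 y.2| := by
  rw [abs_accelerationDensity, abs_of_nonneg hy]
  simp only [renormalizedIntegrand]
  set w := y.2.2 - u y.1 y.2.1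
  set a := ut y.1 y.2.1 + Du y.1 y.2.1 y.2.2
  have h1 := abs_deriv_truncatedPower_sq_le n hp (norm_nonneg w)
  rw [deriv_truncatedPower] at h1 ⊢
  have h2 := truncatedPowerDeriv_nonneg (p := p) n hp (r := ‖w‖ ^ 2) (by positivity)
  rw [abs_of_nonneg h2] at h1
  calc -(f y.1 y.2 * (2 * truncatedPowerDeriv p n (‖w‖ ^ 2)) * (‖w‖ ^ 2 + inner ℝ a w))
      = f y.1 y.2 * (2 * truncatedPowerDeriv p n (‖w‖ ^ 2)) * (-‖w‖ ^ 2 + -inner ℝ a w) := by ring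
    _ ≤ f y.1 y.2 * (2 * truncatedPowerDeriv p n (‖w‖ ^ 2)) * |inner ℝ a w| := by
        gcongr
        have := neg_le_abs (inner ℝ a w)
        have : 0 ≤ ‖w‖ ^ 2 := by positivity
        linarith
    _ ≤ f y.1 y.2 * (2 * (p / 2 * ‖w‖ ^ (p - 2))) * |inner ℝ a w| := by gcongr
    _ = _ := by ring

/-- The dominating function for the last limit, usable once the dissipation density is known to be
integrable. -/
theorem norm_renormalizedIntegrand_truncatedPower_le (hp : 2 ≤ p) (n : ℕ) (y : ℝ × (R3 × R3)) :
    ‖renormalizedIntegrand (truncatedPower p n) u ut Du f y‖ ≤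
      p * (‖dissipationDensity p u f y.1 y.2‖ + ‖accelerationDensity p u ut Du f y.1 y.2‖) := by
  rw [Real.norm_eq_abs (accelerationDensity _ _ _ _ _ _ _), abs_accelerationDensity]
  simp only [renormalizedIntegrand, dissipationDensity]
  set w := y.2.2 - u y.1 y.2.1
  set a := ut y.1 y.2.1 + Du y.1 y.2.1 y.2.2
  have h1 := abs_deriv_truncatedPower_sq_le n hp (norm_nonneg w)
  rw [norm_neg, norm_mul, norm_mul, norm_mul, norm_mul]
  simp only [Real.norm_eq_abs, abs_two]
  rw [abs_of_nonneg (Real.rpow_nonneg (norm_nonneg w) p), ← rpow_sub_two_mul_sq hp (norm_nonneg w)]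
  calc |f y.1 y.2| * (2 * |deriv (truncatedPower p n) (‖w‖ ^ 2)|) * |‖w‖ ^ 2 + inner ℝ a w|
      ≤ |f y.1 y.2| * (2 * (p / 2 * ‖w‖ ^ (p - 2))) * (‖w‖ ^ 2 + |inner ℝ a w|) := by
        gcongr
        refine (abs_add_le _ _).trans ?_
        rw [abs_of_nonneg (by positivity : (0 : ℝ) ≤ ‖w‖ ^ 2)]
    _ = _ := by ring

theorem tendsto_renormalizedIntegrand_truncatedPower (hp : 2 ≤ p) (y : ℝ × (R3 × R3)) :
    Tendsto (fun n => renormalizedIntegrand (truncatedPower p n) u ut Du f y) atTop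
      (𝓝 (-p * (dissipationDensity p u f y.1 y.2 + accelerationDensity p u ut Du f y.1 y.2))) := by
  simp only [renormalizedIntegrand, dissipationDensity, accelerationDensity, deriv_truncatedPower]
  set w := y.2.2 - u y.1 y.2.1
  set a := ut y.1 y.2.1 + Du y.1 y.2.1 y.2.2
  -- At `w = 0` both sides vanish because of the factors `|w|²` and `w`, whatever `γ'(0)` does; this
  -- covers the exceptional case `p = 2`.
  rcases eq_or_ne w 0 with hw | hw
  · rw [hw, norm_zero, Real.zero_rpow (by linarith), inner_zero_right]
    simp
  · have hw0 : 0 < ‖w‖ := norm_pos_iff.2 hw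
    have h1 := tendsto_truncatedPowerDeriv (p := p) (r := ‖w‖ ^ 2) (by positivity)
    rw [sq_rpow_half_sub_one hw0.le] at h1
    have h2 := (((h1.const_mul 2).const_mul (f y.1 y.2)).mul_const (‖w‖ ^ 2 + inner ℝ a w)).neg
    convert h2 using 2
    rw [← rpow_sub_two_mul_sq hp hw0.le]
    ring

theorem integral_mul_truncatedPower_sub (hu : IsL1Lipschitz T u Du) (hut : IsWeakTimeDeriv T u ut)
    (hf : IsVlasovSolution T u f) (hp : 2 ≤ p) (htT : t ≤ T)
    (hA : Integrable (fun y : ℝ × (R3 × R3) => accelerationDensity p u ut Du f y.1 y.2)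
      ((volume.restrict (Ioc 0 t)).prod volume)) {s : ℝ} (hs : s ∈ Icc 0 t) (n : ℕ) :
    (∫ z, f s z * truncatedPower p n (‖z.2 - u s z.1‖ ^ 2)) -
      (∫ z, f 0 z * truncatedPower p n (‖z.2 - u 0 z.1‖ ^ 2)) =
    ∫ y, renormalizedIntegrand (truncatedPower p n) u ut Du f y
      ∂((volume.restrict (Ioc 0 s)).prod volume) := by
  obtain ⟨M, hM0, hM1, hM2⟩ := exists_bound_truncatedPower (p := p) n
  exact renormalized_identity hu hut hf (contDiff_truncatedPower n) hM0 hM1 hM2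
    (fun r hr => abs_deriv_truncatedPower_sq_le n hp hr) ⟨hs.1, hs.2.trans htT⟩
    (hA.mono_measure (restrict_Ioc_prod_le _ hs.2))

theorem tendsto_integral_mul_truncatedPower (hut : IsWeakTimeDeriv T u ut)
    (hf : IsVlasovSolution T u f) (hp : 2 ≤ p) {s : ℝ} (hs : s ∈ Icc 0 T)
    (hD : Integrable (dissipationDensity p u f s)) :
    Tendsto (fun n => ∫ z, f s z * truncatedPower p n (‖z.2 - u s z.1‖ ^ 2)) atTop
      (𝓝 (higherDissipation p u f s)) := by
  refine tendsto_integral_of_dominated_convergence (fun z => ‖dissipationDensity p u f s z‖)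
    (fun n => ?_) hD.norm (fun n => Eventually.of_forall fun z => ?_)
    (Eventually.of_forall fun z => ?_)
  · exact (hf.aestronglyMeasurable_slice s hs).mul
      ((contDiff_truncatedPower n).continuous.comp_aestronglyMeasurable
        ((aestronglyMeasurable_slice_velocity hut hs).norm.pow 2))
  · rw [dissipationDensity, norm_mul, norm_mul]
    gcongr
    rw [Real.norm_eq_abs, Real.norm_eq_abs,
      abs_of_nonneg (truncatedPower_nonneg n hp (by positivity)),
      abs_of_nonneg (Real.rpow_nonneg (norm_nonneg _) _)]
    exact truncatedPower_sq_le n hp (norm_nonneg _)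
  · exact (tendsto_truncatedPower_sq hp (norm_nonneg _)).const_mul _

/-- The favourable sign of the friction term bounds the truncated moments uniformly in `n` and `s`,
without Grönwall's inequality. The bound holds at every `s`, since the renormalized identity does.
-/
theorem lintegral_dissipationDensity_le (hu : IsL1Lipschitz T u Du) (hut : IsWeakTimeDeriv T u ut)
    (hf : IsVlasovSolution T u f) (hp : 2 ≤ p) (htT : t ≤ T)
    (hD0 : Integrable (dissipationDensity p u f 0))
    (hA : Integrable (fun y : ℝ × (R3 × R3) => accelerationDensity p u ut Du f y.1 y.2)
      ((volume.restrict (Ioc 0 t)).prod volume)) {s : ℝ} (hs : s ∈ Icc 0 t) :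
    ∫⁻ z, ‖dissipationDensity p u f s z‖ₑ ≤
      ENNReal.ofReal (higherDissipation p u f 0 +
        p * ∫ y, ‖accelerationDensity p u ut Du f y.1 y.2‖
          ∂((volume.restrict (Ioc 0 t)).prod volume)) := by
  have hsT : s ∈ Icc 0 T := ⟨hs.1, hs.2.trans htT⟩
  have h0T : (0 : ℝ) ∈ Icc 0 T := ⟨le_rfl, hs.1.trans hsT.2⟩
  have hle : (volume.restrict (Ioc 0 s)).prod (volume : Measure (R3 × R3)) ≤
    (volume.restrict (Ioc 0 t)).prod volume := restrict_Ioc_prod_le _ hs.2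
  have hleT : (volume.restrict (Ioc 0 s)).prod (volume : Measure (R3 × R3)) ≤
    (volume.restrict (Ioc 0 T)).prod volume := restrict_Ioc_prod_le _ hsT.2
  have hmeas : ∀ n, AEStronglyMeasurable
      (fun z : R3 × R3 => f s z * truncatedPower p n (‖z.2 - u s z.1‖ ^ 2)) volume := fun n =>
    (hf.aestronglyMeasurable_slice s hsT).mul
      ((contDiff_truncatedPower n).continuous.comp_aestronglyMeasurable
        ((aestronglyMeasurable_slice_velocity hut hsT).norm.pow 2))
  have hbound : ∀ n, ∫⁻ z, ‖f s z * truncatedPower p n (‖z.2 - u s z.1‖ ^ 2)‖ₑ ≤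
      ENNReal.ofReal (higherDissipation p u f 0 +
        p * ∫ y, ‖accelerationDensity p u ut Du f y.1 y.2‖
          ∂((volume.restrict (Ioc 0 t)).prod volume)) := by
    intro n
    obtain ⟨M, hM0, hM1, hM2⟩ := exists_bound_truncatedPower (p := p) n
    have hint : Integrable (fun z : R3 × R3 =>
        f s z * truncatedPower p n (‖z.2 - u s z.1‖ ^ 2)) := by
      refine ((hf.integrable_slice hsT).norm.mul_const M).mono' (hmeas n)
        (Eventually.of_forall fun z => ?_)
      rw [norm_mul]
      gcongr
      exact hM0 _
    have hnn : ∀ᵐ z : R3 × R3, 0 ≤ f s z * truncatedPower p n (‖z.2 - u s z.1‖ ^ 2) := by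
      filter_upwards [hf.nonneg s hsT] with z hz
      exact mul_nonneg hz (truncatedPower_nonneg n hp (by positivity))
    rw [← ofReal_integral_norm_eq_lintegral_enorm hint]
    refine ENNReal.ofReal_le_ofReal ?_
    have h1 : ∫ z, ‖f s z * truncatedPower p n (‖z.2 - u s z.1‖ ^ 2)‖ =
        ∫ z, f s z * truncatedPower p n (‖z.2 - u s z.1‖ ^ 2) := by
      refine integral_congr_ae ?_
      filter_upwards [hnn] with z hz
      rw [Real.norm_eq_abs, abs_of_nonneg hz]
    have h2 := integral_mul_truncatedPower_sub hu hut hf hp htT hA hs n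
    have h3 : ∫ z, f 0 z * truncatedPower p n (‖z.2 - u 0 z.1‖ ^ 2) ≤
        higherDissipation p u f 0 := by
      refine integral_mono_of_nonneg ?_ hD0 ?_
      · filter_upwards [hf.nonneg 0 h0T] with z hz
        exact mul_nonneg hz (truncatedPower_nonneg n hp (by positivity))
      · filter_upwards [hf.nonneg 0 h0T] with z hz
        exact mul_le_mul_of_nonneg_left (truncatedPower_sq_le n hp (norm_nonneg _)) hz
    have hAn := (hA.mono_measure hle).norm.const_mul p
    have h4 : ∫ y, renormalizedIntegrand (truncatedPower p n) u ut Du f y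
        ∂((volume.restrict (Ioc 0 s)).prod volume) ≤
        ∫ y, p * ‖accelerationDensity p u ut Du f y.1 y.2‖
          ∂((volume.restrict (Ioc 0 s)).prod volume) := by
      refine integral_mono_ae ?_ hAn ?_
      · have hfi := hf.integrable_prod.norm.mono_measure hleT
        refine ((hfi.const_mul (2 * M)).add
          ((hA.mono_measure hle).norm.const_mul (2 * (p / 2)))).mono'
          ((aestronglyMeasurable_renormalizedIntegrand hu hut hf
            (contDiff_truncatedPower n)).mono_measure hleT)
          (Eventually.of_forall fun y => ?_)
        exact norm_renormalizedIntegrand_le hM2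
          (fun r hr => abs_deriv_truncatedPower_sq_le n hp hr) y
      · filter_upwards [hleT.absolutelyContinuous.ae_le hf.ae_nonneg_prod] with y hy
        exact renormalizedIntegrand_truncatedPower_le hp n hy
    have h5 : ∫ y, p * ‖accelerationDensity p u ut Du f y.1 y.2‖
          ∂((volume.restrict (Ioc 0 s)).prod volume) ≤
        p * ∫ y, ‖accelerationDensity p u ut Du f y.1 y.2‖
          ∂((volume.restrict (Ioc 0 t)).prod volume) := by
      rw [integral_const_mul]
      refine mul_le_mul_of_nonneg_left ?_ (by linarith)
      exact integral_mono_measure hle (Eventually.of_forall fun _ => norm_nonneg _) hA.norm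
    linarith
  -- Fatou's lemma carries the uniform bound to the untruncated moment.
  calc ∫⁻ z, ‖dissipationDensity p u f s z‖ₑ
      = ∫⁻ z, liminf (fun n => ‖f s z * truncatedPower p n (‖z.2 - u s z.1‖ ^ 2)‖ₑ) atTop := by
        refine lintegral_congr fun z => ?_
        have h1 := ((tendsto_truncatedPower_sq hp (norm_nonneg (z.2 - u s z.1))).const_mul
          (f s z)).enorm
        exact h1.liminf_eq.symm
    _ ≤ liminf (fun n => ∫⁻ z, ‖f s z * truncatedPower p n (‖z.2 - u s z.1‖ ^ 2)‖ₑ) atTop :=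
        lintegral_liminf_le' fun n => (hmeas n).enorm
    _ ≤ _ := by
        refine (liminf_le_liminf (Eventually.of_forall hbound)).trans ?_
        simp

theorem integrable_dissipationDensity (hu : IsL1Lipschitz T u Du) (hut : IsWeakTimeDeriv T u ut)
    (hf : IsVlasovSolution T u f) (hp : 2 ≤ p) (htT : t ≤ T)
    (hD0 : Integrable (dissipationDensity p u f 0))
    (hA : Integrable (fun y : ℝ × (R3 × R3) => accelerationDensity p u ut Du f y.1 y.2)
      ((volume.restrict (Ioc 0 t)).prod volume)) {s : ℝ} (hs : s ∈ Icc 0 t) :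
    Integrable (dissipationDensity p u f s) :=
  ⟨aestronglyMeasurable_dissipationDensity hut hf hp ⟨hs.1, hs.2.trans htT⟩,
    (lintegral_dissipationDensity_le hu hut hf hp htT hD0 hA hs).trans_lt ENNReal.ofReal_lt_top⟩

theorem integrable_dissipationDensity_prod (hu : IsL1Lipschitz T u Du)
    (hut : IsWeakTimeDeriv T u ut) (hf : IsVlasovSolution T u f) (hp : 2 ≤ p) (htT : t ≤ T)
    (hD0 : Integrable (dissipationDensity p u f 0))
    (hA : Integrable (fun y : ℝ × (R3 × R3) => accelerationDensity p u ut Du f y.1 y.2)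
      ((volume.restrict (Ioc 0 t)).prod volume)) :
    Integrable (fun y : ℝ × (R3 × R3) => dissipationDensity p u f y.1 y.2)
      ((volume.restrict (Ioc 0 t)).prod volume) := by
  have hm := (aestronglyMeasurable_dissipationDensity_prod hu hf hp).mono_measure
    (restrict_Ioc_prod_le (volume : Measure (R3 × R3)) htT)
  refine ⟨hm, ?_⟩
  rw [hasFiniteIntegral_iff_enorm, lintegral_prod _ hm.enorm]
  refine lt_of_le_of_lt (setLIntegral_mono' measurableSet_Ioc fun s hs =>
    lintegral_dissipationDensity_le hu hut hf hp htT hD0 hA (Ioc_subset_Icc_self hs)) ?_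
  rw [lintegral_const, Measure.restrict_apply_univ]
  exact ENNReal.mul_lt_top ENNReal.ofReal_lt_top measure_Ioc_lt_top

/-- The evolution of the dissipation in integrated form. -/
theorem higherDissipation_sub (hu : IsL1Lipschitz T u Du)
    (hut : IsWeakTimeDeriv T u ut) (hf : IsVlasovSolution T u f) (hp : 2 ≤ p) (htT : t ≤ T)
    (hD0 : Integrable (dissipationDensity p u f 0))
    (hA : Integrable (fun y : ℝ × (R3 × R3) => accelerationDensity p u ut Du f y.1 y.2)
      ((volume.restrict (Ioc 0 t)).prod volume)) {s : ℝ} (hs : s ∈ Icc 0 t) :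
    higherDissipation p u f s - higherDissipation p u f 0 =
      ∫ τ in (0)..s, -p * (higherDissipation p u f τ +
        ∫ z, accelerationDensity p u ut Du f τ z) := by
  have hsT : s ∈ Icc 0 T := ⟨hs.1, hs.2.trans htT⟩
  have h0T : (0 : ℝ) ∈ Icc 0 T := ⟨le_rfl, hs.1.trans hsT.2⟩
  have hle : (volume.restrict (Ioc 0 s)).prod (volume : Measure (R3 × R3)) ≤
    (volume.restrict (Ioc 0 t)).prod volume := restrict_Ioc_prod_le _ hs.2
  have hleT : (volume.restrict (Ioc 0 s)).prod (volume : Measure (R3 × R3)) ≤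
    (volume.restrict (Ioc 0 T)).prod volume := restrict_Ioc_prod_le _ hsT.2
  have hDI := (integrable_dissipationDensity_prod hu hut hf hp htT hD0 hA).mono_measure hle
  have hAI := hA.mono_measure hle
  have hlim := (tendsto_integral_mul_truncatedPower hut hf hp hsT
    (integrable_dissipationDensity hu hut hf hp htT hD0 hA hs)).sub
    (tendsto_integral_mul_truncatedPower hut hf hp h0T hD0)
  simp_rw [fun n => integral_mul_truncatedPower_sub hu hut hf hp htT hA hs n] at hlim
  have hlim2 : Tendsto (fun n => ∫ y, renormalizedIntegrand (truncatedPower p n) u ut Du f y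
      ∂((volume.restrict (Ioc 0 s)).prod volume)) atTop
      (𝓝 (∫ y, -p * (dissipationDensity p u f y.1 y.2 + accelerationDensity p u ut Du f y.1 y.2)
        ∂((volume.restrict (Ioc 0 s)).prod volume))) := by
    -- The a priori bound, integrated over the bounded time interval, makes this dominating function
    -- integrable.
    refine tendsto_integral_of_dominated_convergence (fun y =>
      p * (‖dissipationDensity p u f y.1 y.2‖ + ‖accelerationDensity p u ut Du f y.1 y.2‖))
      (fun n => ?_) ((hDI.norm.add hAI.norm).const_mul p)
      (fun n => Eventually.of_forall fun y => ?_) (Eventually.of_forall fun y => ?_)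
    · exact (aestronglyMeasurable_renormalizedIntegrand hu hut hf
        (contDiff_truncatedPower n)).mono_measure hleT
    · exact norm_renormalizedIntegrand_truncatedPower_le hp n y
    · exact tendsto_renormalizedIntegrand_truncatedPower hp y
  rw [tendsto_nhds_unique hlim hlim2, integral_const_mul, integral_prod _ (hDI.fun_add hAI),
    intervalIntegral.integral_const_mul, intervalIntegral.integral_of_le hs.1]
  congr 1
  refine integral_congr_ae ?_
  filter_upwards [hDI.prod_right_ae, hAI.prod_right_ae] with τ h1 h2
  exact integral_add h1 h2

end Dissipation

/-! ### Integration by parts in time and conclusion. -/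

/-- Integration by parts for a primitive of an integrable function against a `C¹` function. -/
theorem integral_mul_eq_sub_of_forall_sub_eq_integral {t : ℝ} (ht : 0 ≤ t) {D q φ : ℝ → ℝ}
    (hq : IntervalIntegrable q volume 0 t)
    (hD : ∀ s ∈ Icc 0 t, D s - D 0 = ∫ τ in (0)..s, q τ) (hφ : ContDiffOn ℝ 1 φ (Ici 0)) :
    ∫ s in (0)..t, φ s * q s =
      φ t * D t - φ 0 * D 0 - ∫ s in (0)..t, derivWithin φ (Ici 0) s * D s := by
  -- `D` is known only on `[0,t]`; the primitive `D'` is defined everywhere, absolutely continuous,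
  -- and agrees with `D` there.
  set D' : ℝ → ℝ := fun s => D 0 + ∫ τ in (0)..s, q τ with hD'
  have hDD' : ∀ s ∈ Icc 0 t, D' s = D s := fun s hs => by
    simp only [hD']
    rw [← hD s hs]
    ring
  have hac1 : AbsolutelyContinuousOnInterval (fun s => ∫ τ in (0)..s, q τ) 0 t :=
    hq.absolutelyContinuousOnInterval_intervalIntegral (by simp)
  have hac : AbsolutelyContinuousOnInterval D' 0 t := by
    have hc : AbsolutelyContinuousOnInterval (fun _ : ℝ => D 0) 0 t :=
      (contDiffOn_const (n := 1)).absolutelyContinuousOnInterval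
    exact hc.add hac1
  have hφ' : ContDiffOn ℝ 1 φ (uIcc 0 t) := hφ.mono (by
    rw [uIcc_of_le ht]
    exact Icc_subset_Ici_self)
  have hparts := AbsolutelyContinuousOnInterval.integral_mul_deriv_eq_deriv_mul
    hφ'.absolutelyContinuousOnInterval hac
  have hder : ∫ s in (0)..t, φ s * deriv D' s = ∫ s in (0)..t, φ s * q s := by
    refine intervalIntegral.integral_congr_ae ?_
    filter_upwards [hq.ae_hasDerivAt_integral] with s hs hs'
    have h1 := (hs (uIoc_subset_uIcc hs') 0 left_mem_uIcc).const_add (D 0)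
    rw [h1.deriv]
  have hder2 : ∫ s in (0)..t, deriv φ s * D' s =
      ∫ s in (0)..t, derivWithin φ (Ici 0) s * D s := by
    refine intervalIntegral.integral_congr_ae (Eventually.of_forall fun s hs => ?_)
    rw [uIoc_of_le ht] at hs
    -- The one-sided derivative differs from the full one at most at `s = 0`, which `Ioc 0 t`
    -- excludes.
    rw [hDD' s (Ioc_subset_Icc_self hs), derivWithin_of_mem_nhds (Ici_mem_nhds hs.1)]
  rw [hder, hder2, hDD' t ⟨ht, le_rfl⟩, hDD' 0 ⟨le_rfl, ht⟩] at hparts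
  exact hparts

end

theorem lemma4p2 (T : ℝ) (u ut : ℝ → R3 → R3) (Du : ℝ → R3 → R3 →L[ℝ] R3)
    (f : ℝ → R3 × R3 → ℝ)
    (hu : IsL1Lipschitz T u Du) (hut : IsWeakTimeDeriv T u ut) (hf : IsVlasovSolution T u f)
    (p : ℝ) (hp : 2 ≤ p) (t : ℝ) (ht0 : 0 ≤ t) (htT : t ≤ T)
    (φ : ℝ → ℝ) (hφ : ContDiffOn ℝ 1 φ (Ici 0))
    (hD0 : Integrable (dissipationDensity p u f 0))
    (hA : Integrable (fun y : ℝ × (R3 × R3) => accelerationDensity p u ut Du f y.1 y.2)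
      ((volume.restrict (Ioc 0 t)).prod volume)) :
    (∀ s ∈ Icc 0 t, Integrable (dissipationDensity p u f s)) ∧
    IntervalIntegrable (fun s => higherDissipation p u f s * φ s) volume 0 t ∧
    IntervalIntegrable (fun s => higherDissipation p u f s * derivWithin φ (Ici 0) s) volume 0 t ∧
    ∫ s in (0)..t, higherDissipation p u f s * φ s =
      (1 / p) * (∫ s in (0)..t, higherDissipation p u f s * derivWithin φ (Ici 0) s)
      - (∫ s in (0)..t, ∫ z, accelerationDensity p u ut Du f s z * φ s)
      - (φ t / p * higherDissipation p u f t - φ 0 / p * higherDissipation p u f 0) := by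
  have hDint : IntervalIntegrable (higherDissipation p u f) volume 0 t :=
    (intervalIntegrable_iff_integrableOn_Ioc_of_le ht0).2
      (integrable_dissipationDensity_prod hu hut hf hp htT hD0 hA).integral_prod_left
  have hAint : IntervalIntegrable (fun s => ∫ z, accelerationDensity p u ut Du f s z) volume 0 t :=
    (intervalIntegrable_iff_integrableOn_Ioc_of_le ht0).2 hA.integral_prod_left
  have hsub : uIcc 0 t ⊆ Ici 0 := by
    rw [uIcc_of_le ht0]
    exact Icc_subset_Ici_self
  have hφc : ContinuousOn φ (uIcc 0 t) := hφ.continuousOn.mono hsub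
  have hφc' : ContinuousOn (derivWithin φ (Ici 0)) (uIcc 0 t) :=
    (hφ.continuousOn_derivWithin (uniqueDiffOn_Ici 0) le_rfl).mono hsub
  have hq : IntervalIntegrable (fun τ => -p * (higherDissipation p u f τ +
      ∫ z, accelerationDensity p u ut Du f τ z)) volume 0 t := (hDint.add hAint).const_mul _
  have hparts := integral_mul_eq_sub_of_forall_sub_eq_integral ht0 hq
    (fun s hs => higherDissipation_sub hu hut hf hp htT hD0 hA hs) hφ
  refine ⟨fun s hs => integrable_dissipationDensity hu hut hf hp htT hD0 hA hs,
    hDint.mul_continuousOn hφc, hDint.mul_continuousOn hφc', ?_⟩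
  have h1 : ∫ s in (0)..t, φ s * (-p * (higherDissipation p u f s +
      ∫ z, accelerationDensity p u ut Du f s z)) =
      -p * ((∫ s in (0)..t, higherDissipation p u f s * φ s) +
        ∫ s in (0)..t, ∫ z, accelerationDensity p u ut Du f s z * φ s) := by
    have h2 : ∀ s, ∫ z, accelerationDensity p u ut Du f s z * φ s =
        (∫ z, accelerationDensity p u ut Du f s z) * φ s := fun s => integral_mul_const _ _
    simp_rw [h2]
    rw [← intervalIntegral.integral_add (hDint.mul_continuousOn hφc)
      (hAint.mul_continuousOn hφc), ← intervalIntegral.integral_const_mul]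
    refine intervalIntegral.integral_congr fun s _ => ?_
    ring
  have h3 : ∫ s in (0)..t, derivWithin φ (Ici 0) s * higherDissipation p u f s =
      ∫ s in (0)..t, higherDissipation p u f s * derivWithin φ (Ici 0) s := by
    simp_rw [mul_comm]
  -- `hparts` becomes `-p(∫ D_p φ + ∫ A φ) = [φ D_p] - ∫ D_p φ'`; division by `-p` gives the claim.
  rw [h1, h3] at hparts
  have hp0 : p ≠ 0 := by linarith
  field_simp
  linarith
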